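/- Let $\mathrm{Vec}$ be the category of finite-dimensional complex vector spaces, let $\mathcal{C}$ be a finite-dimensional $2$-vector space over $\mathbb{C}$, i.e. a $\mathbb{C}$-linear category that is $\mathbb{C}$-linearly equivalent to $\mathrm{Vec}^n$ for some $n\ge 0$, and let $I_{\mathcal{C}}$ be the set of isomorphism classes of simple objects of $\mathcal{C}$. For a groupoid $G$, an action of $G$ on a $\mathbb{C}$-linear category $\mathcal{D}$ is a homomorphism from $G$ to the $2$-group $\underline{\mathrm{Aut}}(\mathcal{D})$ of $\mathbb{C}$-linear autoequivalences of $\mathcal{D}$: a $\mathbb{C}$-linear functor $F_g:\mathcal{D}\to\mathcal{D}$ for each arrow $g$, with coherent isomorphisms $F_{1_x}\simeq \mathrm{Id}$ and $F_hF_g\simeq F_{hg}$. Two actions are isomorphic if there are natural isomorphisms $F_g\simeq F'_g$ compatible with these structure isomorphisms. The category of invariants $\mathcal{D}^G$ has as objects families $(M_x)_{x\in G}$ of objects of $\mathcal{D}$ with isomorphisms $F_g(M_x)\simeq M_y$ for $g:x\to y$ that are compatible with the structure isomorphisms, and as morphisms the compatible families of morphisms. The case of a group is that of a groupoid with one object.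 The band of an action of a group $Q$ on $\mathcal{C}$ is the induced homomorphism $Q\to\mathrm{Aut}(I_{\mathcal{C}})$, $q\mapsto([X]\mapsto[q\cdot X])$. Proposition. Let $Q$ be a finite group and let $\rho:Q\to\mathrm{Aut}(I_{\mathcal{C}})$ be an action of $Q$ on the set $I_{\mathcal{C}}$, with action groupoid $Q\ltimes I_{\mathcal{C}}$ (objects $i\in I_{\mathcal{C}}$, arrows $i\to j$ the $q\in Q$ with $\rho(q)i=j$). There is a bijection between isomorphism classes of actions of $Q$ on $\mathcal{C}$ with band $\rho$ and isomorphism classes of actions of $Q\ltimes I_{\mathcal{C}}$ on $\mathrm{Vec}$. Under it the class of $a$ corresponds to the class of $b$ if and only if $b$ is the decoration of $Q\ltimes I_{\mathcal{C}}$ by the lines $\mathrm{Hom}_{\mathcal{C}}(c_j,q\cdot c_i)$ for representatives $c_i\in i$, i.e. if and only if there are $\mathbb{C}$-linear functors $E_i:\mathrm{Vec}\to\mathcal{C}$ with $E_i(\mathbb{C})$ simple of class $i$, and, for all arrows $(q,i):i\to j$, natural isomorphisms $E_j(b_{q,i}(V))\simeq a_q(E_i(V))$ that are compatible with the structure isomorphisms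 of $a$ and $b$. Furthermore, whenever the classes of $a$ and $b$ correspond to each other, $$\mathcal{C}^Q\simeq\mathrm{Vec}^{Q\ltimes I_{\mathcal{C}}}$$ as $\mathbb{C}$-linear categories, the invariants being taken with respect to $a$ and $b$. -/

import Mathlib

open CategoryTheory

universe w v u v' u' v₁ u₁

/-- The category `Vec` of finite-dimensional complex vector spaces. -/
abbrev FdVec := FGModuleCat.{0} ℂ

/-- Two `ℂ`-linear categories are equivalent as `ℂ`-linear categories. -/
def LinearlyEquivalent (C : Type u) [Category.{v} C] [Preadditive C] [Linear ℂ C]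
    (D : Type u') [Category.{v'} D] [Preadditive D] [Linear ℂ D] : Prop :=
  ∃ e : C ≌ D, e.functor.Additive ∧ e.functor.Linear ℂ

/-- A (finite-dimensional) `2`-vector space: a `ℂ`-linear category which is `ℂ`-linearly
equivalent to a finite number `n` of copies of `Vec`. Linearity of a functor into the product
category is linearity of all its components. -/
def IsTwoVectorSpace (C : Type u) [Category.{v} C] [Preadditive C] [Linear ℂ C] : Prop :=
  ∃ (n : ℕ) (e : C ≌ (Fin n → FdVec)),
    ∀ k : Fin n, (e.functor ⋙ Pi.eval (fun _ : Fin n => FdVec) k).Additive ∧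
      (e.functor ⋙ Pi.eval (fun _ : Fin n => FdVec) k).Linear ℂ

section SimpleClasses

variable (C : Type u) [Category.{v} C] [Preadditive C]

/-- Isomorphism of simple objects. -/
instance simpleSetoid : Setoid {X : C // Simple X} where
  r X Y := Nonempty (X.1 ≅ Y.1)
  iseqv := ⟨fun X => ⟨Iso.refl X.1⟩, fun ⟨i⟩ => ⟨i.symm⟩, fun ⟨i⟩ ⟨j⟩ => ⟨i.trans j⟩⟩

/-- The set `I_C` of isomorphism classes of simple objects of `C`. -/
def SimpleClass : Type u := Quotient (simpleSetoid C)

variable {C}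

/-- The isomorphism class of a simple object. -/
def SimpleClass.mk (X : C) (hX : Simple X) : SimpleClass C :=
  Quotient.mk (simpleSetoid C) ⟨X, hX⟩

theorem SimpleClass.mk_eq {X Y : C} (hX : Simple X) (hY : Simple Y) (i : X ≅ Y) :
    SimpleClass.mk X hX = SimpleClass.mk Y hY :=
  Quotient.sound ⟨i⟩

end SimpleClasses

/-- An action of a groupoid `G` on a `ℂ`-linear category `D`, that is, a homomorphism from `G` to
the `2`-group `Aut(D)` of `ℂ`-linear autoequivalences of `D`: a `ℂ`-linear functor `F g : D ⥤ D`
for every arrow `g` (automatically an autoequivalence) together with coherent isomorphisms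
`F (𝟙 x) ≅ 𝟭 D` and `F g ⋙ F h ≅ F (g ≫ h)`. To avoid casts the latter are indexed by
all arrows `k` with a proof of `g ≫ h = k`. -/
structure LinAction (G : Type u₁) [Groupoid.{v₁} G]
    (D : Type u) [Category.{v} D] [Preadditive D] [Linear ℂ D] where
  F {x y : G} (g : x ⟶ y) : D ⥤ D
  additive {x y : G} (g : x ⟶ y) : (F g).Additive
  linear {x y : G} (g : x ⟶ y) : (F g).Linear ℂ
  unit (x : G) : F (𝟙 x) ≅ 𝟭 D
  mul {x y z : G} (g : x ⟶ y) (h : y ⟶ z) (k : x ⟶ z) (w : g ≫ h = k) : F g ⋙ F h ≅ F k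
  mul_assoc {x y z t : G} (g : x ⟶ y) (h : y ⟶ z) (l : z ⟶ t) (gh : x ⟶ z) (hl : y ⟶ t)
    (ghl : x ⟶ t) (w₁ : g ≫ h = gh) (w₂ : h ≫ l = hl) (w₃ : gh ≫ l = ghl) (w₄ : g ≫ hl = ghl)
    (X : D) :
    (F l).map ((mul g h gh w₁).hom.app X) ≫ (mul gh l ghl w₃).hom.app X =
      (mul h l hl w₂).hom.app ((F g).obj X) ≫ (mul g hl ghl w₄).hom.app X
  unit_mul {x y : G} (g : x ⟶ y) (X : D) :
    (mul (𝟙 x) g g (Category.id_comp g)).hom.app X = (F g).map ((unit x).hom.app X)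
  mul_unit {x y : G} (g : x ⟶ y) (X : D) :
    (mul g (𝟙 y) g (Category.comp_id g)).hom.app X = (unit y).hom.app ((F g).obj X)

namespace LinAction

variable {G : Type u₁} [Groupoid.{v₁} G]
  {D : Type u} [Category.{v} D] [Preadditive D] [Linear ℂ D]

instance (a : LinAction G D) {x y : G} (g : x ⟶ y) : (a.F g).Additive := a.additive g

instance (a : LinAction G D) {x y : G} (g : x ⟶ y) : (a.F g).Linear ℂ := a.linear g

/-- Every arrow of the groupoid acts by an autoequivalence. -/
theorem isEquivalence (a : LinAction G D) {x y : G} (g : x ⟶ y) : (a.F g).IsEquivalence :=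
  (CategoryTheory.Equivalence.mk (a.F g) (a.F (Groupoid.inv g))
    ((a.mul g (Groupoid.inv g) (𝟙 x) (Groupoid.comp_inv g)).trans (a.unit x)).symm
    ((a.mul (Groupoid.inv g) g (𝟙 y) (Groupoid.inv_comp g)).trans (a.unit y))).isEquivalence_functor

/-- Isomorphisms of actions, i.e. of homomorphisms from `G` to the `2`-group `Aut(D)`: natural
isomorphisms `a.F g ≅ b.F g` compatible with the structure isomorphisms. -/
structure ActionIso (a b : LinAction G D) where
  η {x y : G} (g : x ⟶ y) : a.F g ≅ b.F g
  unit_η (x : G) (X : D) : (η (𝟙 x)).hom.app X ≫ (b.unit x).hom.app X = (a.unit x).hom.app X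
  mul_η {x y z : G} (g : x ⟶ y) (h : y ⟶ z) (k : x ⟶ z) (w : g ≫ h = k) (X : D) :
    (a.mul g h k w).hom.app X ≫ (η k).hom.app X =
      (a.F h).map ((η g).hom.app X) ≫ (η h).hom.app ((b.F g).obj X) ≫ (b.mul g h k w).hom.app X

/-- The identity isomorphism of an action. -/
def ActionIso.refl (a : LinAction G D) : ActionIso a a where
  η g := Iso.refl _
  unit_η := by simp
  mul_η := by simp

/-- The inverse of an isomorphism of actions. -/
def ActionIso.symm {a b : LinAction G D} (e : ActionIso a b) : ActionIso b a where
  η g := (e.η g).symm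
  unit_η x X := by
    rw [← e.unit_η]
    simp
  mul_η g h k w X := by
    have := e.mul_η g h k w X
    simp only [Iso.symm_hom]
    rw [← cancel_mono ((e.η k).hom.app X)]
    simp only [Category.assoc, Iso.inv_hom_id_app, Category.comp_id, this]
    rw [← Category.assoc, ← Category.assoc, ← Category.assoc]
    rw [show (b.F h).map ((e.η g).inv.app X) ≫ (e.η h).inv.app ((a.F g).obj X) =
      (e.η h).inv.app _ ≫ (a.F h).map ((e.η g).inv.app X) from (e.η h).inv.naturality _]
    simp

/-- The composite of two isomorphisms of actions. -/
def ActionIso.trans {a b c : LinAction G D} (e : ActionIso a b) (f : ActionIso b c) :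
    ActionIso a c where
  η g := e.η g ≪≫ f.η g
  unit_η x X := by
    simp [f.unit_η, e.unit_η]
  mul_η g h k w X := by
    have h₁ := e.mul_η g h k w X
    have h₂ := f.mul_η g h k w X
    simp only [Iso.trans_hom, NatTrans.comp_app, Functor.map_comp, Category.assoc]
    rw [reassoc_of% h₁, h₂]
    simp

variable (G D) in
/-- Actions of `G` on `D` are identified when they are isomorphic. -/
instance setoid : Setoid (LinAction G D) where
  r a b := Nonempty (ActionIso a b)
  iseqv := ⟨fun a => ⟨ActionIso.refl a⟩, fun ⟨e⟩ => ⟨e.symm⟩, fun ⟨e⟩ ⟨f⟩ => ⟨e.trans f⟩⟩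

/-- An object of the category `D^G` of invariants (equivariant objects) of an action of `G` on
`D`: an object `obj x` of `D` for each object `x` of `G`, with compatible isomorphisms
`g · obj x ≅ obj y` for the arrows `g : x ⟶ y`. -/
structure Invariants (a : LinAction G D) where
  obj : G → D
  φ {x y : G} (g : x ⟶ y) : (a.F g).obj (obj x) ≅ obj y
  φ_unit (x : G) : (φ (𝟙 x)).hom = (a.unit x).hom.app (obj x)
  φ_mul {x y z : G} (g : x ⟶ y) (h : y ⟶ z) (k : x ⟶ z) (w : g ≫ h = k) :
    (a.mul g h k w).hom.app (obj x) ≫ (φ k).hom = (a.F h).map (φ g).hom ≫ (φ h).hom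

namespace Invariants

variable {a : LinAction G D}

/-- Morphisms of equivariant objects. -/
@[ext]
structure Hom (M N : Invariants a) where
  app (x : G) : M.obj x ⟶ N.obj x
  comm {x y : G} (g : x ⟶ y) :
    (M.φ g).hom ≫ app y = (a.F g).map (app x) ≫ (N.φ g).hom := by cat_disch

instance : Category (Invariants a) where
  Hom := Hom
  id M := { app := fun x => 𝟙 (M.obj x), comm := by simp }
  comp f g :=
    { app := fun x => f.app x ≫ g.app x
      comm := fun h => by
        rw [← Category.assoc, f.comm, Category.assoc, g.comm]
        simp }
  id_comp _ := Hom.ext (funext fun _ => Category.id_comp _)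
  comp_id _ := Hom.ext (funext fun _ => Category.comp_id _)
  assoc _ _ _ := Hom.ext (funext fun _ => Category.assoc _ _ _)

@[ext]
theorem hom_ext {M N : Invariants a} {f g : M ⟶ N} (h : ∀ x, f.app x = g.app x) : f = g :=
  Hom.ext (funext h)

section

variable {M N : Invariants a}

instance : Zero (M ⟶ N) := ⟨{ app := fun _ => 0, comm := by simp }⟩

instance : Add (M ⟶ N) :=
  ⟨fun f g => { app := fun x => f.app x + g.app x, comm := fun h => by simp [f.comm, g.comm] }⟩

instance : Neg (M ⟶ N) :=
  ⟨fun f => { app := fun x => - f.app x, comm := fun h => by simp [f.comm] }⟩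

instance : Sub (M ⟶ N) :=
  ⟨fun f g => { app := fun x => f.app x - g.app x, comm := fun h => by simp [f.comm, g.comm] }⟩

instance : SMul ℂ (M ⟶ N) :=
  ⟨fun r f => { app := fun x => r • f.app x
                comm := fun h => by simp [f.comm, (a.linear h).map_smul] }⟩

@[simp] theorem zero_app (x : G) : (0 : M ⟶ N).app x = 0 := rfl

@[simp] theorem add_app (f g : M ⟶ N) (x : G) : (f + g).app x = f.app x + g.app x := rfl

@[simp] theorem neg_app (f : M ⟶ N) (x : G) : (-f).app x = -f.app x := rfl

@[simp] theorem sub_app (f g : M ⟶ N) (x : G) : (f - g).app x = f.app x - g.app x := rfl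

@[simp] theorem smul_app (r : ℂ) (f : M ⟶ N) (x : G) : (r • f).app x = r • f.app x := rfl

instance : AddCommGroup (M ⟶ N) where
  add_assoc f g h := by ext x; simp [add_assoc]
  zero_add f := by ext x; simp
  add_zero f := by ext x; simp
  add_comm f g := by ext x; simp [add_comm]
  neg_add_cancel f := by ext x; simp
  sub_eq_add_neg f g := by ext x; simp [sub_eq_add_neg]
  nsmul := nsmulRec
  zsmul := zsmulRec

instance : Module ℂ (M ⟶ N) where
  one_smul f := by ext x; simp
  mul_smul r s f := by ext x; simp [mul_smul]
  smul_zero r := by ext x; simp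
  zero_smul f := by ext x; simp
  smul_add r f g := by ext x; simp
  add_smul r s f := by ext x; simp [add_smul]

end

@[simp] theorem id_app (M : Invariants a) (x : G) : Hom.app (𝟙 M) x = 𝟙 (M.obj x) := rfl

@[simp] theorem comp_app {M N P : Invariants a} (f : M ⟶ N) (g : N ⟶ P) (x : G) :
    (f ≫ g).app x = f.app x ≫ g.app x := rfl

instance : Preadditive (Invariants a) where
  homGroup _ _ := inferInstance
  add_comp _ _ _ f f' g := by ext x; simp
  comp_add _ _ _ f g g' := by ext x; simp

instance : Linear ℂ (Invariants a) where
  homModule _ _ := inferInstance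
  smul_comp _ _ _ r f g := by ext x; simp
  comp_smul _ _ _ f r g := by ext x; simp

end Invariants

end LinAction

section GroupActions

variable {Q : Type w} [Group Q] {C : Type u} [Category.{v} C] [Preadditive C] [Linear ℂ C]

variable (Q C) in
/-- An action of the group `Q` on `C`: an action of `Q` regarded as a groupoid with one object.
Composition in `SingleObj Q` is `f ≫ g = g * f`, so that these are left actions:
the structure isomorphisms are `q · (r · X) ≅ (q * r) · X`. -/
abbrev GroupAction := LinAction (SingleObj Q) C

namespace GroupAction

/-- The functor `q · - : C ⥤ C`. -/
def act (a : GroupAction Q C) (q : Q) : C ⥤ C :=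
  a.F (show SingleObj.star Q ⟶ SingleObj.star Q from q)

/-- `1 · X ≅ X`. -/
def actOne (a : GroupAction Q C) (X : C) : (a.act 1).obj X ≅ X :=
  (a.unit (SingleObj.star Q)).app X

/-- `q · (r · X) ≅ (q * r) · X`. -/
def actMul (a : GroupAction Q C) (q r : Q) (X : C) :
    (a.act q).obj ((a.act r).obj X) ≅ (a.act (q * r)).obj X :=
  (a.mul (show SingleObj.star Q ⟶ SingleObj.star Q from r)
    (show SingleObj.star Q ⟶ SingleObj.star Q from q) _ rfl).app X

theorem simple_act (a : GroupAction Q C) (q : Q) {X : C} (hX : Simple X) :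
    Simple ((a.act q).obj X) :=
  haveI : (a.act q).IsEquivalence := a.isEquivalence _
  simple_obj (a.act q) X

/-- The map `[X] ↦ [q · X]` on isomorphism classes of simple objects. -/
def bandFun (a : GroupAction Q C) (q : Q) : SimpleClass C → SimpleClass C :=
  Quotient.map' (fun X => ⟨(a.act q).obj X.1, a.simple_act q X.2⟩)
    (fun _ _ ⟨i⟩ => ⟨(a.act q).mapIso i⟩)

theorem bandFun_mk (a : GroupAction Q C) (q : Q) (X : C) (hX : Simple X) :
    a.bandFun q (SimpleClass.mk X hX) = SimpleClass.mk ((a.act q).obj X) (a.simple_act q hX) :=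
  rfl

theorem bandFun_one (a : GroupAction Q C) (i : SimpleClass C) : a.bandFun 1 i = i := by
  obtain ⟨X, hX⟩ := i
  exact SimpleClass.mk_eq _ hX (a.actOne X)

theorem bandFun_mul (a : GroupAction Q C) (q r : Q) (i : SimpleClass C) :
    a.bandFun (q * r) i = a.bandFun q (a.bandFun r i) := by
  obtain ⟨X, hX⟩ := i
  exact (SimpleClass.mk_eq (a.simple_act q (a.simple_act r hX)) _ (a.actMul q r X)).symm

/-- The band of an action of `Q` on `C`: the induced homomorphism `Q → Aut(I_C)`. -/
def band (a : GroupAction Q C) : Q →* Equiv.Perm (SimpleClass C) where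
  toFun q :=
    { toFun := a.bandFun q
      invFun := a.bandFun q⁻¹
      left_inv := fun i => by rw [← bandFun_mul, inv_mul_cancel, bandFun_one]
      right_inv := fun i => by rw [← bandFun_mul, mul_inv_cancel, bandFun_one] }
  map_one' := Equiv.ext fun i => a.bandFun_one i
  map_mul' q r := Equiv.ext fun i => a.bandFun_mul q r i

end GroupAction

/-- The isomorphism classes of actions of `Q` on `C` with band `ρ`. -/
def ActionsWithBand (ρ : Q →* Equiv.Perm (SimpleClass C)) :=
  Quotient ((LinAction.setoid (SingleObj Q) C).comap
    (Subtype.val : {a : GroupAction Q C // a.band = ρ} → GroupAction Q C))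

/-- The isomorphism class of an action of `Q` on `C` with band `ρ`. -/
def ActionsWithBand.mk {ρ : Q →* Equiv.Perm (SimpleClass C)} (a : GroupAction Q C)
    (ha : a.band = ρ) : ActionsWithBand ρ :=
  Quotient.mk _ ⟨a, ha⟩

end GroupActions

section ActionGroupoids

variable {Q : Type w} [Group Q] {I : Type u} (ρ : Q →* Equiv.Perm I)

/-- The action groupoid `Q ⋉ I` of an action `ρ` of `Q` on a set `I`: the objects are the elements
of `I`, and the arrows `i ⟶ j` are the `q : Q` with `ρ q i = j`. -/
def ActionGroupoid : Type u :=
  @ActionCategory Q _ I (MulAction.compHom I ρ)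

instance : Groupoid.{w} (ActionGroupoid ρ) :=
  letI := MulAction.compHom I ρ
  inferInstanceAs (Groupoid (ActionCategory Q I))

namespace ActionGroupoid

variable {ρ}

/-- The element of `I` underlying an object of `Q ⋉ I`. -/
def pt (x : ActionGroupoid ρ) : I :=
  letI := MulAction.compHom I ρ
  ActionCategory.back x

variable (ρ) in
/-- The projection `Q ⋉ I ⥤ Q`, which sends an arrow to its label. -/
def proj : ActionGroupoid ρ ⥤ SingleObj Q :=
  letI := MulAction.compHom I ρ
  ActionCategory.π Q I

theorem hom_eq (x y : ActionGroupoid ρ) : (x ⟶ y) = {q : Q // ρ q x.pt = y.pt} := rfl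

theorem proj_map {x y : ActionGroupoid ρ} (g : x ⟶ y) : (proj ρ).map g = g.val := rfl

end ActionGroupoid

/-- The isomorphism classes of actions of `Q ⋉ I` on `Vec`. -/
def ActionsOnVec := Quotient (LinAction.setoid (ActionGroupoid ρ) FdVec)

variable {ρ} in
/-- The isomorphism class of an action of `Q ⋉ I` on `Vec`. -/
noncomputable def ActionsOnVec.mk (b : LinAction (ActionGroupoid ρ) FdVec) : ActionsOnVec ρ :=
  Quotient.mk _ b

end ActionGroupoids

/-- An identification of `b`, an action of `Q ⋉ I_C` on `Vec`, with the decoration of `Q ⋉ I_C` by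
the lines `Hom(c_j, q · c_i)` that is obtained from an action `a` of `Q` on `C` and a choice of
representatives `c_i ∈ i`. Here the representatives are encoded by the linear functors
`E i = (- ⊗ c_i) : Vec ⥤ C`. For an arrow `g : i ⟶ j` with label `q`, the isomorphism `θ g` is
`b_g(V) ⊗ c_j ≅ q · (V ⊗ c_i)`; for `V = ℂ` it identifies the line `b_g(ℂ)` with
`Hom(c_j, q · c_i)`. The isomorphisms `θ` have to respect the structure of the two actions. -/
structure Decoration {Q : Type w} [Group Q]
    {C : Type u} [Category.{v} C] [Preadditive C] [Linear ℂ C]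
    {ρ : Q →* Equiv.Perm (SimpleClass C)}
    (a : GroupAction Q C) (b : LinAction (ActionGroupoid ρ) FdVec) where
  E (i : SimpleClass C) : FdVec ⥤ C
  additive (i : SimpleClass C) : (E i).Additive
  linear (i : SimpleClass C) : (E i).Linear ℂ
  simple (i : SimpleClass C) : Simple ((E i).obj (FGModuleCat.of ℂ ℂ))
  mk_eq (i : SimpleClass C) : SimpleClass.mk ((E i).obj (FGModuleCat.of ℂ ℂ)) (simple i) = i
  θ {x y : ActionGroupoid ρ} (g : x ⟶ y) :
    b.F g ⋙ E y.pt ≅ E x.pt ⋙ a.F ((ActionGroupoid.proj ρ).map g)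
  θ_unit (x : ActionGroupoid ρ) (V : FdVec) :
    (θ (𝟙 x)).hom.app V ≫ (a.unit ((ActionGroupoid.proj ρ).obj x)).hom.app ((E x.pt).obj V) =
      (E x.pt).map ((b.unit x).hom.app V)
  θ_mul {x y z : ActionGroupoid ρ} (g : x ⟶ y) (h : y ⟶ z) (k : x ⟶ z) (w : g ≫ h = k)
    (V : FdVec) :
    (E z.pt).map ((b.mul g h k w).hom.app V) ≫ (θ k).hom.app V =
      (θ h).hom.app ((b.F g).obj V) ≫
        (a.F ((ActionGroupoid.proj ρ).map h)).map ((θ g).hom.app V) ≫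
          (a.mul ((ActionGroupoid.proj ρ).map g) ((ActionGroupoid.proj ρ).map h)
            ((ActionGroupoid.proj ρ).map k) (by rw [← w, Functor.map_comp])).hom.app
            ((E x.pt).obj V)

/-! Choose for every class `i` a linear functor `E i : FdVec ⥤ C` that sends the line to a simple
object of class `i`. By Schur's lemma and semisimplicity these functors form a frame
(`IsTwoVectorSpace.isFrame`): they are fully faithful and mutually orthogonal, and every object is a
direct sum of objects `(E i).obj (N i)`. So `C` is a sum of copies of `FdVec` indexed by the simple
classes, and linear functors and natural transformations out of `C` can be prescribed summand by
summand.

Call an action `a` of `Q` on `C` and an action `b` of `Q ⋉ I_C` on `FdVec` related if there are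
coherent isomorphisms `b_g ⋙ E y ≅ E x ⋙ a_q` for the arrows `g` with label `q` (`Intertwiner`). If
`a` has band `ρ`, then `a_q` carries the summand `i` to the summand `ρ q i`, and full faithfulness
transports the structure of `a` to a related `b`, unique up to isomorphism. Conversely, the functors
`b_g` with label `q` assemble to one functor `a_q` on `C`, and the structure isomorphisms of `b`
extend uniquely from the summands (`exists_intertwiner_target`, `Intertwiner.nonempty_actionIso`). A
relation that pairs the classes in this way is a bijection (`exists_quotient_equiv`). It does not
depend on the frame, since two choices of `E i` are isomorphic (`nonempty_decoration_iff`).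

For the invariants, decompose an equivariant object of `C` as the sum of the `(E i).obj (N i)`.
Orthogonality leaves a single matrix entry of `q · M ≅ M` for each arrow of the action groupoid, and
the intertwiner turns it into an isomorphism `b_g (N i) ≅ N j`. `Assembly` records this passage
between equivariant objects of `FdVec` and of `C`. -/

/-- The one-dimensional vector space `ℂ` as an object of `FdVec`. -/
noncomputable abbrev FdVec.line : FdVec := FGModuleCat.of ℂ ℂ

/-! ### The line generates `FdVec` -/

namespace FdVec

theorem exists_eq_smul_id (f : line ⟶ line) : ∃ c : ℂ, f = c • 𝟙 line := by
  refine ⟨f.hom.hom (1 : ℂ), ?_⟩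
  ext
  change f.hom.hom (1 : ℂ) = f.hom.hom (1 : ℂ) • (1 : ℂ)
  simp

theorem id_line_ne_zero : 𝟙 line ≠ 0 := by
  intro h
  have := congrArg (fun f : line ⟶ line => f.hom.hom (1 : ℂ)) h
  exact one_ne_zero (α := ℂ) this

/-- A basis of `V` and its dual basis, as morphisms from and to the line. -/
theorem exists_basis (V : FdVec) : ∃ (n : ℕ) (a : Fin n → (line ⟶ V)) (b : Fin n → (V ⟶ line)),
    (∀ s, a s ≫ b s = 𝟙 line) ∧ (∀ s t, s ≠ t → a s ≫ b t = 0) ∧ ∑ s, b s ≫ a s = 𝟙 V := by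
  let B := Module.finBasis ℂ V
  refine ⟨_, fun s => FGModuleCat.ofHom (LinearMap.toSpanSingleton ℂ V (B s)),
    fun s => FGModuleCat.ofHom (B.coord s), fun s => ?_, fun s t h => ?_, ?_⟩
  · ext
    change B.coord s ((1 : ℂ) • B s) = (1 : ℂ)
    simp
  · ext
    change B.coord t ((1 : ℂ) • B s) = (0 : ℂ)
    simp [h]
  ext x
  have : ∀ (f : Fin (Module.finrank ℂ V) → (V ⟶ V)),
      (∑ s, f s).hom.hom x = ∑ s, (f s).hom.hom x := by
    intro f
    let ev : (V ⟶ V) →+ V :=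
      { toFun := fun g => g.hom.hom x, map_zero' := rfl, map_add' := fun _ _ => rfl }
    exact map_sum ev f _
  rw [this]
  exact B.sum_repr x

/-- A nonzero linear map has a nonzero matrix entry, and rescaling a basis vector makes it `1`. -/
theorem exists_comp_eq_id {V W : FdVec} {f : V ⟶ W} (hf : f ≠ 0) :
    ∃ (v : line ⟶ V) (w : W ⟶ line), v ≫ f ≫ w = 𝟙 line := by
  obtain ⟨n, a, b, -, -, hV⟩ := exists_basis V
  obtain ⟨m, a', b', -, -, hW⟩ := exists_basis W
  by_contra! h
  apply hf
  have key : ∀ s t, a s ≫ f ≫ b' t = 0 := by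
    intro s t
    obtain ⟨c, hc⟩ := exists_eq_smul_id (a s ≫ f ≫ b' t)
    by_cases h0 : c = 0
    · rw [hc, h0, zero_smul]
    · refine absurd ?_ (h (c⁻¹ • a s) (b' t))
      rw [Linear.smul_comp, hc, smul_smul, inv_mul_cancel₀ h0, one_smul]
  rw [← Category.comp_id f, ← Category.id_comp f, ← hV, ← hW, Preadditive.sum_comp,
    Preadditive.sum_comp]
  refine Finset.sum_eq_zero fun s _ => ?_
  rw [Preadditive.comp_sum]
  refine Finset.sum_eq_zero fun t _ => ?_
  have := key s t
  simp only [Category.assoc]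
  rw [reassoc_of% this]
  simp

section

variable {C : Type u} [Category.{v} C] [Preadditive C]
  {E E' : FdVec ⥤ C}

/-- The identity of `V` is a finite sum of maps through the line, and an additive functor keeps it
so. -/
theorem hom_ext_of_line [E.Additive] {V : FdVec} {X : C} {f g : E.obj V ⟶ X}
    (h : ∀ v : line ⟶ V, E.map v ≫ f = E.map v ≫ g) : f = g := by
  obtain ⟨n, a, b, -, -, hV⟩ := exists_basis V
  rw [← Category.id_comp f, ← Category.id_comp g, ← E.map_id, ← hV, E.map_sum,
    Preadditive.sum_comp, Preadditive.sum_comp]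
  simp only [E.map_comp, Category.assoc, h]

theorem natTrans_ext [E.Additive] {α β : E ⟶ E'} (h : α.app line = β.app line) : α = β := by
  ext V
  exact hom_ext_of_line fun v => by simp [h]

variable [Linear ℂ C] [E.Linear ℂ] [E'.Linear ℂ]

theorem map_comp_comm (e : line ⟶ line) (f : E.obj line ⟶ E'.obj line) :
    E.map e ≫ f = f ≫ E'.map e := by
  obtain ⟨c, rfl⟩ := exists_eq_smul_id e
  simp [E.map_smul, E'.map_smul]

variable [E.Additive] [E'.Additive]

/-- Endomorphisms of the line are scalars, so naturality imposes no condition on `f`. The component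
at `V` is `f` applied along a basis; `key` characterizes it without reference to the basis, and
naturality follows. -/
theorem exists_natTrans (f : E.obj line ⟶ E'.obj line) : ∃ α : E ⟶ E', α.app line = f := by
  choose n a b _ _ hV using exists_basis
  have key : ∀ (V : FdVec) (v : line ⟶ V),
      E.map v ≫ ∑ s, E.map (b V s) ≫ f ≫ E'.map (a V s) = f ≫ E'.map v := by
    intro V v
    rw [Preadditive.comp_sum]
    calc _ = ∑ s, f ≫ E'.map (v ≫ b V s ≫ a V s) := by
          refine Finset.sum_congr rfl fun s _ => ?_
          have := map_comp_comm (v ≫ b V s) f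
          rw [← E.map_comp_assoc, reassoc_of% this]
          simp
      _ = _ := by
          rw [← Preadditive.comp_sum, ← E'.map_sum, ← Preadditive.comp_sum, hV, Category.comp_id]
  refine ⟨{ app := fun V => ∑ s, E.map (b V s) ≫ f ≫ E'.map (a V s), naturality := ?_ }, ?_⟩
  · intro V W g
    refine hom_ext_of_line fun v => ?_
    rw [← E.map_comp_assoc, key, reassoc_of% key, E'.map_comp]
  · have := key line (𝟙 _)
    simpa using this

theorem nonempty_iso (f : E.obj line ≅ E'.obj line) : Nonempty (E ≅ E') := by
  obtain ⟨α, hα⟩ := exists_natTrans f.hom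
  obtain ⟨β, hβ⟩ := exists_natTrans f.inv
  exact ⟨⟨α, β, natTrans_ext (by simp [hα, hβ]), natTrans_ext (by simp [hα, hβ])⟩⟩

end

end FdVec

/-! ### Coordinates, generators, biproducts and tensors in a `2`-vector space -/

section TwoVectorSpaces

open Limits

variable {C : Type u} [Category.{v} C] [Preadditive C] [Linear ℂ C]

/-- The coordinate functors of a `2`-vector space. -/
theorem IsTwoVectorSpace.exists_coordinates (hC : IsTwoVectorSpace C) :
    ∃ (n : ℕ) (U : Fin n → C ⥤ FdVec), (∀ k, (U k).Additive) ∧ (∀ k, (U k).Linear ℂ) ∧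
      (∀ (X Y : C) (f g : X ⟶ Y), (∀ k, (U k).map f = (U k).map g) → f = g) ∧
      (∀ (X Y : C) (φ : ∀ k, (U k).obj X ⟶ (U k).obj Y), ∃ f : X ⟶ Y, ∀ k, (U k).map f = φ k) ∧
      ∀ W : Fin n → FdVec, ∃ X : C, Nonempty (∀ k, (U k).obj X ≅ W k) := by
  obtain ⟨n, e, he⟩ := hC
  refine ⟨n, fun k => e.functor ⋙ Pi.eval (fun _ : Fin n => FdVec) k, fun k => (he k).1,
    fun k => (he k).2, fun X Y f g h => e.functor.map_injective (funext h),
    fun X Y φ => ⟨e.functor.preimage φ, fun k => ?_⟩,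
    fun W => ⟨e.inverse.obj W, ⟨fun k => Pi.isoApp (e.counitIso.app W) k⟩⟩⟩
  exact congrFun (e.functor.map_preimage (Y := Y) φ) k

/-- A `2`-vector space has a finite family of pairwise orthogonal objects with scalar
endomorphisms, of which every object is a finite direct sum. -/
theorem IsTwoVectorSpace.exists_generators (hC : IsTwoVectorSpace C) :
    ∃ (n : ℕ) (x : Fin n → C), (∀ k l, k ≠ l → ∀ f : x k ⟶ x l, f = 0) ∧
      (∀ k, 𝟙 (x k) ≠ 0) ∧ (∀ k (f : x k ⟶ x k), ∃ c : ℂ, f = c • 𝟙 (x k)) ∧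
      ∀ X : C, ∃ (S : Type) (_ : Fintype S) (κ : S → Fin n) (a : ∀ s, x (κ s) ⟶ X)
        (b : ∀ s, X ⟶ x (κ s)), (∀ s, a s ≫ b s = 𝟙 _) ∧ (∀ s t, s ≠ t → a s ≫ b t = 0) ∧
          ∑ s, b s ≫ a s = 𝟙 X := by
  obtain ⟨n, U, hA, hL, hU, hF, hS⟩ := hC.exists_coordinates
  -- `x k` has the line as its `k`-th coordinate and the zero space as every other one.
  choose x ix using fun k : Fin n =>
    hS fun j => if j = k then FdVec.line else FGModuleCat.of ℂ PUnit
  have i : ∀ k, (U k).obj (x k) ≅ FdVec.line := fun k => (ix k).some k ≪≫ eqToIso (if_pos rfl)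
  have hz : ∀ j k, j ≠ k → 𝟙 ((U j).obj (x k)) = 0 := by
    intro j k h
    have e : (U j).obj (x k) ≅ FGModuleCat.of ℂ PUnit := (ix k).some j ≪≫ eqToIso (if_neg h)
    have h0 : 𝟙 (FGModuleCat.of ℂ PUnit) = 0 := rfl
    rw [← e.hom_inv_id, ← Category.id_comp e.inv, h0]
    simp
  have hsrc : ∀ j k, j ≠ k → ∀ {W : FdVec} (f : (U j).obj (x k) ⟶ W), f = 0 := by
    intro j k h W f
    rw [← Category.id_comp f, hz j k h, zero_comp]
  have htgt : ∀ j k, j ≠ k → ∀ {W : FdVec} (f : W ⟶ (U j).obj (x k)), f = 0 := by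
    intro j k h W f
    rw [← Category.comp_id f, hz j k h, comp_zero]
  have ext_src : ∀ k {Y : C} (f g : x k ⟶ Y), (U k).map f = (U k).map g → f = g := by
    intro k Y f g h
    refine hU _ _ _ _ fun j => ?_
    by_cases hj : j = k
    · subst hj; exact h
    · rw [hsrc j k hj ((U j).map f), hsrc j k hj ((U j).map g)]
  have lift_src : ∀ k {Y : C} (f : (U k).obj (x k) ⟶ (U k).obj Y),
      ∃ g : x k ⟶ Y, (U k).map g = f := by
    intro k Y f
    obtain ⟨g, hg⟩ := hF (x k) Y (Function.update (fun _ => 0) k f)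
    exact ⟨g, by simpa using hg k⟩
  have lift_tgt : ∀ k {Y : C} (f : (U k).obj Y ⟶ (U k).obj (x k)),
      ∃ g : Y ⟶ x k, (U k).map g = f := by
    intro k Y f
    obtain ⟨g, hg⟩ := hF Y (x k) (Function.update (fun _ => 0) k f)
    exact ⟨g, by simpa using hg k⟩
  have horth : ∀ k l, k ≠ l → ∀ f : x k ⟶ x l, f = 0 := fun k l h f =>
    ext_src k _ _ (by rw [htgt k l h ((U k).map f), Functor.map_zero])
  refine ⟨n, x, horth, fun k h => ?_, fun k f => ?_, fun X => ?_⟩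
  · have h0 := congrArg (U k).map h
    rw [CategoryTheory.Functor.map_id, Functor.map_zero] at h0
    apply FdVec.id_line_ne_zero
    rw [← (i k).inv_hom_id, ← Category.id_comp (i k).hom, h0]
    simp
  · obtain ⟨c, hc⟩ := FdVec.exists_eq_smul_id ((i k).inv ≫ (U k).map f ≫ (i k).hom)
    refine ⟨c, ext_src k _ _ ?_⟩
    rw [(U k).map_smul, (U k).map_id, ← cancel_epi (i k).inv, ← cancel_mono (i k).hom]
    simp only [Category.assoc, hc]
    simp
  · choose N a b h1 h2 h3 using fun k => FdVec.exists_basis ((U k).obj X)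
    choose a' ha' using fun k (s : Fin (N k)) =>
      lift_src k (Y := X) ((i k).hom ≫ a k s)
    choose b' hb' using fun k (s : Fin (N k)) =>
      lift_tgt k (Y := X) (b k s ≫ (i k).inv)
    refine ⟨Σ k, Fin (N k), inferInstance, Sigma.fst, fun s => a' s.1 s.2,
      fun s => b' s.1 s.2, fun s => ?_, fun s t hst => ?_, ?_⟩
    · refine ext_src _ _ _ ?_
      rw [Functor.map_comp, ha', hb', Category.assoc, reassoc_of% h1]
      simp
    · obtain ⟨k, s⟩ := s
      obtain ⟨l, t⟩ := t
      by_cases hkl : k = l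
      · subst hkl
        refine ext_src _ _ _ ?_
        have hst' : s ≠ t := fun h => hst (by rw [h])
        rw [Functor.map_comp, ha', hb', Category.assoc, reassoc_of% (h2 k s t hst')]
        simp
      · exact horth k l hkl _
    · refine hU _ _ _ _ fun j => ?_
      rw [Functor.map_sum, Fintype.sum_sigma, Finset.sum_eq_single j]
      · rw [CategoryTheory.Functor.map_id, ← h3 j]
        refine Finset.sum_congr rfl fun s _ => ?_
        rw [Functor.map_comp, ha', hb']
        simp
      · intro k _ hk
        refine Finset.sum_eq_zero fun s _ => ?_
        rw [Functor.map_comp, hsrc j k hk.symm ((U j).map (a' k s)), comp_zero]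
      · simp

/-- The biproduct is formed in each coordinate and lifted with its projections and inclusions; the
identities hold because the coordinates are jointly faithful. -/
theorem IsTwoVectorSpace.hasBiproduct (hC : IsTwoVectorSpace C) {J : Type w} [Finite J]
    (Y : J → C) : HasBiproduct Y := by
  classical
  obtain ⟨n, U, hA, hL, hU, hF, hS⟩ := hC.exists_coordinates
  have := Fintype.ofFinite J
  have : HasFiniteBiproducts FdVec := HasFiniteBiproducts.of_hasFiniteProducts
  obtain ⟨X, ⟨i⟩⟩ := hS fun k => ⨁ fun j => (U k).obj (Y j)
  choose p hp using fun j => hF X (Y j) fun k =>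
    (i k).hom ≫ biproduct.π (fun j => (U k).obj (Y j)) j
  choose q hq using fun j => hF (Y j) X fun k =>
    biproduct.ι (fun j => (U k).obj (Y j)) j ≫ (i k).inv
  let B : Bicone Y :=
    { pt := X
      π := p
      ι := q
      ι_π := fun j j' => hU _ _ _ _ fun k => by
        rw [Functor.map_comp, hp, hq]
        by_cases h : j = j'
        · subst h
          simp
        · simp [h] }
  refine HasBiproduct.mk ⟨B, isBilimitOfTotal B (hU _ _ _ _ fun k => ?_)⟩
  change (U k).map (∑ j, p j ≫ q j) = (U k).map (𝟙 X)
  rw [Functor.map_sum]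
  simp only [Functor.map_comp, hp, hq, Category.assoc]
  rw [← Preadditive.comp_sum]
  simp only [← Category.assoc]
  have biproduct_total : ∑ j, biproduct.π (fun j => (U k).obj (Y j)) j ≫
      biproduct.ι (fun j => (U k).obj (Y j)) j = 𝟙 _ :=
    IsBilimit.total (biproduct.isBilimit fun j => (U k).obj (Y j))
  rw [← Preadditive.sum_comp, biproduct_total]
  simp

/-- A `2`-vector space is tensored over `FdVec`. -/
theorem IsTwoVectorSpace.exists_tensor (hC : IsTwoVectorSpace C) (X : C) :
    ∃ (E : FdVec ⥤ C), E.Additive ∧ E.Linear ℂ ∧ Nonempty (E.obj FdVec.line ≅ X) := by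
  obtain ⟨n, U, hA, hL, hU, hF, hS⟩ := hC.exists_coordinates
  -- The coordinates of `V ⊗ X` are `V ⊗ U k X`; the action on morphisms is lifted from there.
  choose T i using fun V : FdVec => hS fun k => MonoidalCategory.tensorObj V ((U k).obj X)
  replace i := fun V => (i V).some
  choose m hm using fun (V W : FdVec) (f : V ⟶ W) => hF (T V) (T W) fun k =>
    (i V k).hom ≫ MonoidalCategory.whiskerRight f ((U k).obj X) ≫ (i W k).inv
  let E : FdVec ⥤ C :=
    { obj := T
      map := fun f => m _ _ f
      map_id := fun V => hU _ _ _ _ fun k => by simp [hm]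
      map_comp := fun f g => hU _ _ _ _ fun k => by simp [hm] }
  refine ⟨E, ⟨fun {V W f g} => hU _ _ _ _ fun k => ?_⟩,
    ⟨fun f r => hU _ _ _ _ fun k => ?_⟩, ?_⟩
  · simp [E, hm, Functor.map_add, MonoidalPreadditive.add_whiskerRight]
  · simp [E, hm, Functor.map_smul, MonoidalLinear.smul_whiskerRight]
  · let l : ∀ k, (U k).obj (T FdVec.line) ≅ (U k).obj X := fun k =>
      i FdVec.line k ≪≫ MonoidalCategory.leftUnitor ((U k).obj X)
    obtain ⟨f, hf⟩ := hF _ _ fun k => (l k).hom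
    obtain ⟨g, hg⟩ := hF _ _ fun k => (l k).inv
    exact ⟨⟨f, g, hU _ _ _ _ fun k => by simp [hf, hg], hU _ _ _ _ fun k => by simp [hf, hg]⟩⟩

end TwoVectorSpaces

/-! ### Schur's lemma and decomposition into isotypic summands -/

section Frames

open Limits

theorem SimpleClass.exact {C : Type u} [Category.{v} C] [Preadditive C]
    {X Y : C} {hX : Simple X} {hY : Simple Y}
    (h : SimpleClass.mk X hX = SimpleClass.mk Y hY) : Nonempty (X ≅ Y) :=
  Quotient.exact h

/-- A frame of `C`: a finite family of linear functors `FdVec ⥤ C` which identifies `C` with a direct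
sum of copies of `FdVec`. -/
structure IsFrame {C : Type u} [Category.{v} C] [Preadditive C] [Linear ℂ C]
    {I : Type w} [Fintype I] (E : I → FdVec ⥤ C) : Prop where
  additive (i : I) : (E i).Additive
  linear (i : I) : (E i).Linear ℂ
  faithful (i : I) : (E i).Faithful
  full (i : I) : (E i).Full
  orthogonal {i j : I} (h : i ≠ j) {V W : FdVec} (f : (E i).obj V ⟶ (E j).obj W) : f = 0
  exists_decomposition (X : C) : ∃ (N : I → FdVec) (ι : ∀ i, (E i).obj (N i) ⟶ X)
    (π : ∀ i, X ⟶ (E i).obj (N i)), (∀ i, ι i ≫ π i = 𝟙 _) ∧ ∑ i, π i ≫ ι i = 𝟙 X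

variable {C : Type u} [Category.{v} C] [Preadditive C] [Linear ℂ C]

/-- The simple objects of a `2`-vector space. -/
theorem IsTwoVectorSpace.exists_simple_generators (hC : IsTwoVectorSpace C) :
    ∃ (n : ℕ) (x : Fin n → C), (∀ k, Simple (x k)) ∧ (∀ k l, k ≠ l → ∀ f : x k ⟶ x l, f = 0) ∧
      (∀ k (f : x k ⟶ x k), ∃ c : ℂ, f = c • 𝟙 (x k)) ∧
      (∀ X : C, Simple X → ∃ k, Nonempty (X ≅ x k)) ∧
      ∀ X : C, ∃ (S : Type) (_ : Fintype S) (κ : S → Fin n) (a : ∀ s, x (κ s) ⟶ X)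
        (b : ∀ s, X ⟶ x (κ s)), (∀ s, a s ≫ b s = 𝟙 _) ∧ (∀ s t, s ≠ t → a s ≫ b t = 0) ∧
          ∑ s, b s ≫ a s = 𝟙 X := by
  obtain ⟨n, x, horth, hne, hend, hdec⟩ := hC.exists_generators
  -- A nonzero map into a generator splits: between generators because it is a nonzero scalar, in
  -- general because it is nonzero on some summand of its source. This makes the generators simple,
  -- and every simple object isomorphic to one of them.
  have hsplit₀ : ∀ k l (f : x l ⟶ x k), f ≠ 0 → ∃ r : x k ⟶ x l, r ≫ f = 𝟙 _ := by
    intro k l f hf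
    by_cases h : l = k
    · subst h
      obtain ⟨c, rfl⟩ := hend l f
      have hc : c ≠ 0 := fun h => hf (by simp [h])
      exact ⟨c⁻¹ • 𝟙 _, by simp [smul_smul, hc]⟩
    · exact absurd (horth l k h f) hf
  have hsplit : ∀ k {Y : C} (f : Y ⟶ x k), f ≠ 0 → ∃ r : x k ⟶ Y, r ≫ f = 𝟙 _ := by
    intro k Y f hf
    obtain ⟨S, _, κ, a, b, -, -, hS⟩ := hdec Y
    have : ∃ s, a s ≫ f ≠ 0 := by
      by_contra! h
      exact hf (by rw [← Category.id_comp f, ← hS, Preadditive.sum_comp]; simp [h])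
    obtain ⟨s, hs⟩ := this
    obtain ⟨r, hr⟩ := hsplit₀ _ _ _ hs
    exact ⟨r ≫ a s, by simpa using hr⟩
  refine ⟨n, x, fun k => ⟨fun {Y} f _ => ⟨fun h0 hf => ?_, fun hf => ?_⟩⟩, horth, hend,
    fun X hX => ?_, hdec⟩
  · exact hne k ((IsIso.inv_hom_id f).symm.trans ((congrArg (inv f ≫ ·) hf).trans comp_zero))
  · obtain ⟨r, hr⟩ := hsplit k f hf
    exact ⟨r, by rw [← cancel_mono f]; simp [hr], hr⟩
  · obtain ⟨S, _, κ, a, b, -, -, hS⟩ := hdec X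
    have : ∃ s, b s ≠ 0 := by
      by_contra! h
      exact id_nonzero X (by rw [← hS]; simp [h])
    obtain ⟨s, hs⟩ := this
    obtain ⟨r, hr⟩ := hsplit _ _ hs
    have : IsSplitMono r := ⟨⟨_, hr⟩⟩
    have : IsIso r := isIso_of_mono_of_nonzero
      (fun h => hne (κ s) (by rw [← hr, h, zero_comp]))
    exact ⟨κ s, ⟨(asIso r).symm⟩⟩

theorem IsTwoVectorSpace.finite_simpleClass (hC : IsTwoVectorSpace C) :
    Finite (SimpleClass C) := by
  obtain ⟨n, x, hx, -, -, hsimple, -⟩ := hC.exists_simple_generators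
  refine Finite.of_surjective (fun k => SimpleClass.mk (x k) (hx k)) ?_
  rintro ⟨X, hX⟩
  obtain ⟨k, ⟨i⟩⟩ := hsimple X hX
  exact ⟨k, SimpleClass.mk_eq _ _ i.symm⟩

/-- Nonzero morphisms between simple objects exist only inside an isomorphism class. -/
theorem IsTwoVectorSpace.mk_eq_of_ne_zero (hC : IsTwoVectorSpace C) {X Y : C} (hX : Simple X)
    (hY : Simple Y) {f : X ⟶ Y} (hf : f ≠ 0) : SimpleClass.mk X hX = SimpleClass.mk Y hY := by
  obtain ⟨n, x, hx, horth, -, hsimple, -⟩ := hC.exists_simple_generators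
  obtain ⟨k, ⟨i⟩⟩ := hsimple X hX
  obtain ⟨l, ⟨j⟩⟩ := hsimple Y hY
  by_cases h : k = l
  · subst h
    exact SimpleClass.mk_eq _ _ (i.trans j.symm)
  · refine absurd ?_ hf
    have := horth k l h (i.inv ≫ f ≫ j.hom)
    rw [← cancel_epi i.inv, ← cancel_mono j.hom]
    simpa using this

theorem IsTwoVectorSpace.exists_eq_smul_id (hC : IsTwoVectorSpace C) {X : C} (hX : Simple X)
    (f : X ⟶ X) : ∃ c : ℂ, f = c • 𝟙 X := by
  obtain ⟨n, x, hx, -, hend, hsimple, -⟩ := hC.exists_simple_generators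
  obtain ⟨k, ⟨i⟩⟩ := hsimple X hX
  obtain ⟨c, hc⟩ := hend k (i.inv ≫ f ≫ i.hom)
  refine ⟨c, ?_⟩
  rw [← cancel_epi i.inv, ← cancel_mono i.hom]
  simp [hc]

/-- A map from `E i V` to `E j W` is a matrix with entries in `Hom(E i ℂ, E j ℂ)`, which by Schur's
lemma is zero for `i ≠ j` and consists of scalars for `i = j`. An object is a sum of simple objects,
and those of class `i` are collected into one isotypic summand. -/
theorem IsTwoVectorSpace.isFrame (hC : IsTwoVectorSpace C) [Fintype (SimpleClass C)]
    (E : SimpleClass C → FdVec ⥤ C) (hA : ∀ i, (E i).Additive) (hL : ∀ i, (E i).Linear ℂ)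
    (hs : ∀ i, Simple ((E i).obj FdVec.line))
    (hE : ∀ i, SimpleClass.mk ((E i).obj FdVec.line) (hs i) = i) : IsFrame E := by
  classical
  have hmat : ∀ {i j : SimpleClass C} {V W : FdVec} (f : (E i).obj V ⟶ (E j).obj W),
      (∀ v w, (E i).map v ≫ f ≫ (E j).map w = (0 : (E i).obj FdVec.line ⟶ (E j).obj FdVec.line)) →
        f = 0 := by
    intro i j V W f h
    refine FdVec.hom_ext_of_line fun v => ?_
    obtain ⟨n, a, b, -, -, hW⟩ := FdVec.exists_basis W
    rw [comp_zero, ← Category.comp_id ((E i).map v ≫ f), ← (E j).map_id, ← hW, (E j).map_sum,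
      Preadditive.comp_sum]
    refine Finset.sum_eq_zero fun s _ => ?_
    have := h v (b s)
    simp only [Functor.map_comp, Category.assoc]
    rw [reassoc_of% this, zero_comp]
  refine ⟨hA, hL, fun i => ⟨fun {V W f g} hfg => ?_⟩, fun i => ⟨fun {V W} f => ?_⟩,
    fun {i j} hij V W f => hmat f fun v w => ?_, fun X => ?_⟩
  · by_contra hne
    obtain ⟨v, w, hvw⟩ := FdVec.exists_comp_eq_id (sub_ne_zero.mpr hne)
    apply id_nonzero ((E i).obj FdVec.line)
    rw [← (E i).map_id, ← hvw]
    simp [Functor.map_sub, hfg]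
  · obtain ⟨n, a, b, -, -, hV⟩ := FdVec.exists_basis V
    obtain ⟨m, a', b', -, -, hW⟩ := FdVec.exists_basis W
    choose c hc using fun s t => hC.exists_eq_smul_id (hs i)
      ((E i).map (a s) ≫ f ≫ (E i).map (b' t))
    refine ⟨∑ s, ∑ t, b s ≫ (c s t • 𝟙 _) ≫ a' t, ?_⟩
    rw [← Category.id_comp f, ← Category.comp_id f, ← (E i).map_id, ← (E i).map_id, ← hV, ← hW]
    simp only [Functor.map_sum, Preadditive.sum_comp, Preadditive.comp_sum, Functor.map_comp,
      Functor.map_smul, CategoryTheory.Functor.map_id, ← hc, Category.assoc]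
    exact Finset.sum_comm
  · by_contra hne
    exact hij ((hE i).symm.trans ((hC.mk_eq_of_ne_zero (hs i) (hs j) hne).trans (hE j)))
  · obtain ⟨n, x, hx, -, -, -, hdec⟩ := hC.exists_simple_generators
    obtain ⟨S, _, κ, a, b, hab, hab', hS⟩ := hdec X
    let cl : S → SimpleClass C := fun s => SimpleClass.mk (x (κ s)) (hx _)
    have hiso : ∀ s i, cl s = i → Nonempty (x (κ s) ≅ (E i).obj FdVec.line) :=
      fun s i h => SimpleClass.exact (hX := hx _) (hY := hs i) (h.trans (hE i).symm)
    -- `T i` is the set of simple summands of class `i`, and `N i` is the multiplicity space with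
    -- basis `T i`.
    let T : SimpleClass C → Type := fun i => {s : S // cl s = i}
    let φ : ∀ i (s : T i), x (κ s.1) ≅ (E i).obj FdVec.line := fun i s => (hiso s.1 i s.2).some
    let N : SimpleClass C → FdVec := fun i => FGModuleCat.of ℂ (T i → ℂ)
    let p : ∀ i (s : T i), N i ⟶ FdVec.line := fun i s =>
      FGModuleCat.ofHom (LinearMap.proj s : (T i → ℂ) →ₗ[ℂ] ℂ)
    let q : ∀ i (s : T i), FdVec.line ⟶ N i := fun i s =>
      FGModuleCat.ofHom (LinearMap.single ℂ (fun _ : T i => ℂ) s)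
    have hqp : ∀ i s, q i s ≫ p i s = 𝟙 _ := by
      intro i s
      ext
      change (Pi.single s (1 : ℂ) : T i → ℂ) s = 1
      simp
    have hqp' : ∀ i s t, s ≠ t → q i s ≫ p i t = 0 := by
      intro i s t h
      ext
      change (Pi.single s (1 : ℂ) : T i → ℂ) t = 0
      simp [h.symm]
    have hpq : ∀ i, ∑ s, p i s ≫ q i s = 𝟙 (N i) := by
      intro i
      refine FGModuleCat.hom_ext (LinearMap.ext fun z => ?_)
      let ev : (N i ⟶ N i) →+ (T i → ℂ) :=
        { toFun := fun g => g.hom.hom z, map_zero' := rfl, map_add' := fun _ _ => rfl }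
      refine (map_sum ev _ _).trans ?_
      exact Finset.univ_sum_single (z : T i → ℂ)
    refine ⟨N, fun i => ∑ s, (E i).map (p i s) ≫ (φ i s).inv ≫ a s.1,
      fun i => ∑ s, b s.1 ≫ (φ i s).hom ≫ (E i).map (q i s), fun i => ?_, ?_⟩
    · rw [← (E i).map_id, ← hpq, Functor.map_sum, Preadditive.sum_comp]
      refine Finset.sum_congr rfl fun s _ => ?_
      rw [Preadditive.comp_sum, Finset.sum_eq_single s]
      · simp [reassoc_of% hab s.1]
      · intro t _ hts
        have := hab' s.1 t.1 (fun h => hts (Subtype.ext h.symm))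
        simp only [Category.assoc]
        rw [reassoc_of% this]
        simp
      · simp
    · rw [← hS, ← Finset.sum_fiberwise Finset.univ cl]
      refine Finset.sum_congr rfl fun i _ => ?_
      rw [Finset.sum_subtype (p := fun s => cl s = i) _ (by simp), Preadditive.sum_comp]
      refine Finset.sum_congr rfl fun s _ => ?_
      rw [Preadditive.comp_sum, Finset.sum_eq_single s]
      · simp only [Category.assoc]
        rw [← (E i).map_comp_assoc, hqp]
        simp
      · intro t _ hts
        simp only [Category.assoc]
        rw [← (E i).map_comp_assoc, hqp' _ _ _ hts.symm]
        simp
      · simp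

theorem IsTwoVectorSpace.exists_frame (hC : IsTwoVectorSpace C) :
    ∃ (E : SimpleClass C → FdVec ⥤ C), (∀ i, (E i).Additive) ∧ (∀ i, (E i).Linear ℂ) ∧
      ∃ hs : ∀ i, Simple ((E i).obj FdVec.line),
        ∀ i, SimpleClass.mk ((E i).obj FdVec.line) (hs i) = i := by
  have : ∀ i : SimpleClass C, ∃ E : FdVec ⥤ C, E.Additive ∧ E.Linear ℂ ∧
      ∃ hs : Simple (E.obj FdVec.line), SimpleClass.mk (E.obj FdVec.line) hs = i := by
    rintro ⟨X, hX⟩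
    obtain ⟨E, hA, hL, ⟨i⟩⟩ := hC.exists_tensor X
    have hs : Simple (E.obj FdVec.line) := Simple.of_iso i
    exact ⟨E, hA, hL, hs, SimpleClass.mk_eq hs hX i⟩
  choose E hA hL hs hE using this
  exact ⟨E, hA, hL, hs, hE⟩

end Frames

/-! ### Functors and natural transformations prescribed on a frame -/

namespace IsFrame

open Limits

variable {C : Type u} [Category.{v} C] [Preadditive C] [Linear ℂ C]
  {D : Type u'} [Category.{v'} D] [Preadditive D]
  {I : Type w} [Fintype I] {E : I → FdVec ⥤ C}

theorem hom_ext (hE : IsFrame E) (F : C ⥤ D) [F.Additive] {X : C} {Z : D} {f g : F.obj X ⟶ Z}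
    (h : ∀ (i : I) (V : FdVec) (u : (E i).obj V ⟶ X), F.map u ≫ f = F.map u ≫ g) : f = g := by
  obtain ⟨N, ι, π, -, hX⟩ := hE.exists_decomposition X
  rw [← Category.id_comp f, ← Category.id_comp g, ← F.map_id, ← hX, F.map_sum,
    Preadditive.sum_comp, Preadditive.sum_comp]
  simp only [F.map_comp, Category.assoc, h]

theorem natTrans_ext (hE : IsFrame E) {F G : C ⥤ D} [F.Additive] {α β : F ⟶ G}
    (h : ∀ (i : I) (V : FdVec), α.app ((E i).obj V) = β.app ((E i).obj V)) : α = β := by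
  ext X
  exact hE.hom_ext F fun i V u => by simp [h]

/-- Natural transformations may be constructed on the summands of a frame. -/
theorem exists_natTrans (hE : IsFrame E) {F G : C ⥤ D} [F.Additive] [G.Additive]
    (α : ∀ i, E i ⋙ F ⟶ E i ⋙ G) :
    ∃ β : F ⟶ G, ∀ (i : I) (V : FdVec), β.app ((E i).obj V) = (α i).app V := by
  have hfull := hE.full
  choose N ι π _ hX using hE.exists_decomposition
  -- By orthogonality `u` meets only the summand `i` of `X`, where `u ≫ π X i` comes from `FdVec`
  -- and naturality of `α i` applies. This characterizes the component at `X` independently of the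
  -- chosen decomposition.
  have key : ∀ (X : C) (i : I) (V : FdVec) (u : (E i).obj V ⟶ X),
      F.map u ≫ ∑ j, F.map (π X j) ≫ (α j).app (N X j) ≫ G.map (ι X j) =
        (α i).app V ≫ G.map u := by
    intro X i V u
    have h : ∀ j, F.map (u ≫ π X j) ≫ (α j).app (N X j) ≫ G.map (ι X j) =
        (α i).app V ≫ G.map (u ≫ π X j ≫ ι X j) := by
      intro j
      by_cases hij : i = j
      · subst hij
        have := (α i).naturality ((E i).preimage (u ≫ π X i))
        simp only [Functor.comp_map, Functor.map_preimage] at this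
        rw [reassoc_of% this, ← G.map_comp, Category.assoc]
      · have h0 : u ≫ π X j = 0 := hE.orthogonal hij _
        rw [h0, reassoc_of% h0]
        simp
    calc _ = ∑ j, (α i).app V ≫ G.map (u ≫ π X j ≫ ι X j) := by
          rw [Preadditive.comp_sum]
          refine Finset.sum_congr rfl fun j _ => ?_
          rw [← h, F.map_comp, Category.assoc]
      _ = _ := by
          rw [← Preadditive.comp_sum, ← G.map_sum, ← Preadditive.comp_sum, hX, Category.comp_id]
  refine ⟨{ app := fun X => ∑ j, F.map (π X j) ≫ (α j).app (N X j) ≫ G.map (ι X j),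
            naturality := fun X Y f => hE.hom_ext F fun i V u => ?_ }, fun i V => ?_⟩
  · rw [← F.map_comp_assoc, key, reassoc_of% key, G.map_comp]
  · have := key _ i V (𝟙 _)
    simpa using this

theorem exists_iso (hE : IsFrame E) {F G : C ⥤ D} [F.Additive] [G.Additive]
    (α : ∀ i, E i ⋙ F ≅ E i ⋙ G) :
    ∃ β : F ≅ G, ∀ (i : I) (V : FdVec), β.hom.app ((E i).obj V) = (α i).hom.app V := by
  obtain ⟨β, hβ⟩ := hE.exists_natTrans fun i => (α i).hom
  obtain ⟨γ, hγ⟩ := hE.exists_natTrans fun i => (α i).inv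
  exact ⟨⟨β, γ, hE.natTrans_ext fun i V => by simp [hβ, hγ],
    hE.natTrans_ext fun i V => by simp [hβ, hγ]⟩, hβ⟩

/-- The coordinate functors of a frame. -/
theorem exists_coordinates (hE : IsFrame E) :
    ∃ H : I → C ⥤ FdVec, (∀ i, (H i).Additive) ∧ (∀ i, (H i).Linear ℂ) ∧
      (∀ i, Nonempty (E i ⋙ H i ≅ 𝟭 _)) ∧
      ∀ i j, i ≠ j → ∀ V, 𝟙 ((H j).obj ((E i).obj V)) = 0 := by
  have hA := hE.additive
  have hL := hE.linear
  have hfull := hE.full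
  have hfaith := hE.faithful
  choose N ι π hιπ hX using hE.exists_decomposition
  -- Every morphism is block diagonal, so its diagonal blocks compose; hence the multiplicity spaces
  -- are functorial.
  have key : ∀ {X Y : C} (f : X ⟶ Y) (i : I), (ι X i ≫ f ≫ π Y i) ≫ ι Y i = ι X i ≫ f := by
    intro X Y f i
    conv_rhs => rw [← Category.comp_id f, ← hX, Preadditive.comp_sum, Preadditive.comp_sum]
    rw [Finset.sum_eq_single i]
    · simp
    · intro j _ hji
      have h0 : ι X i ≫ f ≫ π Y j = 0 := hE.orthogonal hji.symm _
      rw [reassoc_of% h0, zero_comp]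
    · simp
  let H : I → C ⥤ FdVec := fun i =>
    { obj := fun X => N X i
      map := fun {X Y} f => (E i).preimage (ι X i ≫ f ≫ π Y i)
      map_id := fun X => (E i).map_injective (by simp [hιπ])
      map_comp := fun {X Y Z} f g => (E i).map_injective (by
        rw [Functor.map_preimage, Functor.map_comp, Functor.map_preimage, Functor.map_preimage,
          Category.assoc, Category.assoc, Category.assoc, reassoc_of% key f i]) }
  have hzero : ∀ i j, i ≠ j → ∀ V, 𝟙 (N ((E i).obj V) j) = 0 := by
    intro i j h V
    apply (E j).map_injective
    have h0 : π ((E i).obj V) j = 0 := hE.orthogonal h _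
    rw [CategoryTheory.Functor.map_id, ← hιπ, h0, comp_zero, Functor.map_zero]
  have hone : ∀ i V, π ((E i).obj V) i ≫ ι ((E i).obj V) i = 𝟙 _ := by
    intro i V
    rw [← hX, Finset.sum_eq_single i]
    · intro j _ hji
      have h0 : π ((E i).obj V) j = 0 := hE.orthogonal hji.symm _
      rw [h0, zero_comp]
    · simp
  refine ⟨H, fun i => ⟨fun {X Y f g} => (E i).map_injective ?_⟩,
    fun i => ⟨fun f r => (E i).map_injective ?_⟩, fun i => ⟨NatIso.ofComponents (fun V =>
      ⟨(E i).preimage (ι _ i), (E i).preimage (π _ i), (E i).map_injective ?_,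
        (E i).map_injective ?_⟩) fun f => (E i).map_injective ?_⟩, hzero⟩
  · simp [H, Functor.map_add]
  · simp [H, Functor.map_smul]
  · simp only [Functor.map_comp, Functor.map_preimage, CategoryTheory.Functor.map_id]
    exact hιπ _ _
  · simp only [Functor.map_comp, Functor.map_preimage, CategoryTheory.Functor.map_id]
    exact hone _ _
  · simp only [H, Functor.comp_map, Functor.map_comp, Functor.map_preimage, Functor.id_map]
    exact key _ _

/-- Linear functors may be constructed on the summands of a frame. -/
theorem exists_functor (hE : IsFrame E) (hB : ∀ Y : I → C, HasBiproduct Y)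
    (T : I → FdVec ⥤ C) (hTA : ∀ i, (T i).Additive) (hTL : ∀ i, (T i).Linear ℂ) :
    ∃ F : C ⥤ C, F.Additive ∧ F.Linear ℂ ∧ ∀ i, Nonempty (E i ⋙ F ≅ T i) := by
  classical
  obtain ⟨H, hA, hL, hone, hzero⟩ := hE.exists_coordinates
  -- `F` is the sum of the functors `H i ⋙ T i`. After `E i` only the summand `i` survives, since `H
  -- j` vanishes on the image of `E i` for `j ≠ i`.
  let F : C ⥤ C :=
    { obj := fun X => ⨁ fun i => (T i).obj ((H i).obj X)
      map := fun f => biproduct.map fun i => (T i).map ((H i).map f)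
      map_id := fun X => by ext; simp
      map_comp := fun f g => by ext; simp }
  refine ⟨F, ⟨fun {X Y f g} => ?_⟩, ⟨fun f r => ?_⟩, fun i => ⟨?_⟩⟩
  · refine biproduct.hom_ext _ _ fun i => ?_
    simp [F, Functor.map_add]
  · refine biproduct.hom_ext _ _ fun i => ?_
    simp [F, Functor.map_smul]
  · let ε := (hone i).some
    refine NatIso.ofComponents (fun V =>
      ⟨biproduct.π (fun j => (T j).obj ((H j).obj ((E i).obj V))) i ≫ (T i).map (ε.hom.app V),
        (T i).map (ε.inv.app V) ≫ biproduct.ι (fun j => (T j).obj ((H j).obj ((E i).obj V))) i,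
        ?_, ?_⟩) fun f => ?_
    · refine biproduct.hom_ext' _ _ fun j => ?_
      by_cases hij : i = j
      · subst hij
        simp [← Functor.map_comp_assoc]
        exact (Category.comp_id _).symm
      · have h0 : 𝟙 ((T j).obj ((H j).obj ((E i).obj V))) = 0 := by
          rw [← (T j).map_id, hzero i j hij V, Functor.map_zero]
        rw [← Category.id_comp (biproduct.ι _ j), h0]
        simp
    · simp [← Functor.map_comp]
    · have := ε.hom.naturality f
      simp only [Functor.comp_map, Functor.id_map] at this
      simp [F, ← Functor.map_comp, this]

end IsFrame

/-! ### Intertwiners between actions of a groupoid -/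

namespace LinAction

variable {G : Type u₁} [Groupoid.{v₁} G]
  {B : Type u'} [Category.{v'} B] [Preadditive B] [Linear ℂ B]
  {C : Type u} [Category.{v} C] [Preadditive C] [Linear ℂ C]

/-- Compatible isomorphisms `g · E x V ≅ E y (g · V)` for a family of functors `E x : B ⥤ C`
between categories with actions of a groupoid `G`. -/
structure Intertwiner (a : LinAction G C) (b : LinAction G B) (E : G → B ⥤ C) where
  θ {x y : G} (g : x ⟶ y) : b.F g ⋙ E y ≅ E x ⋙ a.F g
  θ_unit (x : G) (V : B) :
    (θ (𝟙 x)).hom.app V ≫ (a.unit x).hom.app ((E x).obj V) = (E x).map ((b.unit x).hom.app V)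
  θ_mul {x y z : G} (g : x ⟶ y) (h : y ⟶ z) (k : x ⟶ z) (w : g ≫ h = k) (V : B) :
    (E z).map ((b.mul g h k w).hom.app V) ≫ (θ k).hom.app V =
      (θ h).hom.app ((b.F g).obj V) ≫ (a.F h).map ((θ g).hom.app V) ≫
        (a.mul g h k w).hom.app ((E x).obj V)

theorem unit_naturality (a : LinAction G C) (x : G) {X Y : C} (f : X ⟶ Y) :
    (a.F (𝟙 x)).map f ≫ (a.unit x).hom.app Y = (a.unit x).hom.app X ≫ f :=
  (a.unit x).hom.naturality f

theorem mul_naturality (a : LinAction G C) {x y z : G} (g : x ⟶ y) (h : y ⟶ z) (k : x ⟶ z)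
    (w : g ≫ h = k) {X Y : C} (f : X ⟶ Y) :
    (a.F h).map ((a.F g).map f) ≫ (a.mul g h k w).hom.app Y =
      (a.mul g h k w).hom.app X ≫ (a.F k).map f :=
  (a.mul g h k w).hom.naturality f

namespace Intertwiner

variable {a a' : LinAction G C} {b b' : LinAction G B} {E E' : G → B ⥤ C}

theorem θ_naturality (T : Intertwiner a b E) {x y : G} (g : x ⟶ y) {V W : B} (f : V ⟶ W) :
    (E y).map ((b.F g).map f) ≫ (T.θ g).hom.app W =
      (T.θ g).hom.app V ≫ (a.F g).map ((E x).map f) :=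
  (T.θ g).hom.naturality f

/-- Replace the functors `E x` by isomorphic ones. -/
def ofIso (T : Intertwiner a b E) (φ : ∀ x, E x ≅ E' x) : Intertwiner a b E' where
  θ {x y} g := Functor.isoWhiskerLeft (b.F g) (φ y).symm ≪≫ T.θ g ≪≫
    Functor.isoWhiskerRight (φ x) (a.F g)
  θ_unit x V := by
    have h := T.θ_unit x V
    simp only [Iso.trans_hom, Functor.isoWhiskerLeft_hom, Functor.isoWhiskerRight_hom,
      Iso.symm_hom, NatTrans.comp_app, Functor.whiskerLeft_app, Functor.whiskerRight_app,
      Category.assoc, unit_naturality]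
    rw [reassoc_of% h, ← (φ x).inv.naturality_assoc]
    simp
  θ_mul {x y z} g h k w V := by
    have h₁ := T.θ_mul g h k w V
    simp only [Iso.trans_hom, Functor.isoWhiskerLeft_hom, Functor.isoWhiskerRight_hom,
      Iso.symm_hom, NatTrans.comp_app, Functor.whiskerLeft_app, Functor.whiskerRight_app,
      Category.assoc, Functor.map_comp]
    rw [mul_naturality, (φ z).inv.naturality_assoc, reassoc_of% h₁, ← Functor.map_comp_assoc]
    simp

/-- Replace the action on the target by an isomorphic one. -/
def ofActionIso (T : Intertwiner a b E) (e : ActionIso a a') : Intertwiner a' b E where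
  θ {x y} g := T.θ g ≪≫ Functor.isoWhiskerLeft (E x) (e.η g)
  θ_unit x V := by
    simp [e.unit_η, T.θ_unit]
  θ_mul {x y z} g h k w V := by
    have h₁ := T.θ_mul g h k w V
    have h₂ := e.mul_η g h k w ((E x).obj V)
    have h₃ := (e.η h).hom.naturality ((T.θ g).hom.app V)
    simp only [Functor.comp_obj] at h₃
    simp only [Iso.trans_hom, Functor.isoWhiskerLeft_hom, NatTrans.comp_app,
      Functor.whiskerLeft_app, Category.assoc, Functor.map_comp]
    rw [reassoc_of% h₁, h₂]
    simp

/-- Replace the action on the source by an isomorphic one. -/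
def ofActionIsoSource (T : Intertwiner a b E) (e : ActionIso b b') : Intertwiner a b' E where
  θ {x y} g := Functor.isoWhiskerRight (e.η g).symm (E y) ≪≫ T.θ g
  θ_unit x V := by
    have h := e.symm.unit_η x V
    rw [← h, Functor.map_comp, ← T.θ_unit]
    simp [ActionIso.symm]
  θ_mul {x y z} g h k w V := by
    have h₁ := T.θ_mul g h k w V
    have h₂ := e.symm.mul_η g h k w V
    have h₃ := T.θ_naturality h ((e.η g).inv.app V)
    have h₄ := (e.η h).inv.naturality ((e.η g).inv.app V)
    simp only [ActionIso.symm, Iso.symm_hom] at h₂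
    simp only [Iso.trans_hom, Functor.isoWhiskerRight_hom, NatTrans.comp_app,
      Functor.whiskerRight_app, Category.assoc, Functor.map_comp, Iso.symm_hom]
    rw [← Functor.map_comp_assoc, h₂, Functor.map_comp, Functor.map_comp, Category.assoc,
      Category.assoc, h₁, ← reassoc_of% h₃, ← Functor.map_comp_assoc, h₄]
    simp

/-- The action on the source is determined up to isomorphism by the action on the target. -/
noncomputable def actionIsoSource (T : Intertwiner a b E) (T' : Intertwiner a b' E) [∀ x, (E x).Full]
    [∀ x, (E x).Faithful] : ActionIso b b' where
  -- Under `E y` both `b_g V` and `b'_g V` become `g · E x V`.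
  η {x y} g := NatIso.ofComponents (fun V => (E y).preimageIso ((T.θ g ≪≫ (T'.θ g).symm).app V))
    fun f => (E y).map_injective (by
      have h := (T.θ g ≪≫ (T'.θ g).symm).hom.naturality f
      simpa using h)
  unit_η x V := (E x).map_injective (by
    have h := T'.θ_unit x V
    simp [← T.θ_unit, ← h])
  mul_η {x y z} g h k w V := (E z).map_injective (by
    have h₁ := T.θ_mul g h k w V
    have h₂ := T'.θ_mul g h k w V
    have h₃ := T.θ_naturality h ((E y).preimage ((T.θ g).hom.app V ≫ (T'.θ g).inv.app V))
    simp only [Functor.map_preimage] at h₃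
    rw [← cancel_mono ((T'.θ k).hom.app V)]
    simp only [Functor.map_comp, Category.assoc, NatIso.ofComponents_hom_app,
      Functor.preimageIso_hom, Functor.map_preimage, Iso.app_hom, Iso.trans_hom,
      NatTrans.comp_app, Iso.symm_hom, Iso.inv_hom_id_app, Category.comp_id, h₁, h₂,
      Iso.inv_hom_id_app_assoc, reassoc_of% h₃]
    have h₄ : (T.θ g).hom.app V =
        ((T.θ g).hom.app V ≫ (T'.θ g).inv.app V) ≫ (T'.θ g).hom.app V := by simp
    conv_lhs => rw [h₄, Functor.map_comp, Category.assoc]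
    simp only [Functor.map_comp, Category.assoc])

end Intertwiner

/-- An action on the target of a family of fully faithful functors can be restricted to the
source. -/
theorem exists_intertwiner_source (a : LinAction G C) (E : G → B ⥤ C) [∀ x, (E x).Full]
    [∀ x, (E x).Faithful] (θ : ∀ {x y : G} (g : x ⟶ y), E y ≅ E x ⋙ a.F g) :
    ∃ b : LinAction G B, Nonempty (Intertwiner a b E) := by
  -- Since `E y ≅ E x ⋙ a.F g`, every arrow may act on `B` by the identity functor. The whole
  -- content of the action then lies in `υ` and `μ`, obtained by conjugating the structure of `a`
  -- with `θ`; for `B = FdVec` this is a scalar `2`-cocycle.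
  let υ : ∀ x, 𝟭 B ≅ 𝟭 B := fun x => NatIso.ofComponents
    (fun V => (E x).preimageIso ((θ (𝟙 x) ≪≫ Functor.isoWhiskerLeft (E x) (a.unit x)).app V))
    fun f => (E x).map_injective (by
      simp)
  let μ : ∀ {x y z : G} (g : x ⟶ y) (h : y ⟶ z) (k : x ⟶ z) (w : g ≫ h = k),
      𝟭 B ⋙ 𝟭 B ≅ 𝟭 B := fun {x y z} g h k w => NatIso.ofComponents
    (fun V => (E z).preimageIso ((θ h ≪≫ Functor.isoWhiskerRight (θ g) (a.F h) ≪≫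
      Functor.isoWhiskerLeft (E x) (a.mul g h k w) ≪≫ (θ k).symm).app V))
    fun f => (E z).map_injective (by
      have h := (θ h ≪≫ Functor.isoWhiskerRight (θ g) (a.F h) ≪≫
        Functor.isoWhiskerLeft (E x) (a.mul g h k w) ≪≫ (θ k).symm).hom.naturality f
      simpa using h)
  have hυ : ∀ x V, (E x).map ((υ x).hom.app V) =
      (θ (𝟙 x)).hom.app V ≫ (a.unit x).hom.app ((E x).obj V) := by
    intro x V
    simp [υ]
  have hμ : ∀ {x y z : G} (g : x ⟶ y) (h : y ⟶ z) (k : x ⟶ z) (w : g ≫ h = k) (V : B),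
      (E z).map ((μ g h k w).hom.app V) ≫ (θ k).hom.app V =
      (θ h).hom.app V ≫ (a.F h).map ((θ g).hom.app V) ≫
        (a.mul g h k w).hom.app ((E x).obj V) := by
    intro x y z g h k w V
    simp [μ]
  have hθ : ∀ {x y : G} (g : x ⟶ y) {V W : B} (f : V ⟶ W), (E y).map f ≫ (θ g).hom.app W =
      (θ g).hom.app V ≫ (a.F g).map ((E x).map f) := fun g _ _ f => (θ g).hom.naturality f
  refine ⟨{ F := fun g => 𝟭 B, additive := inferInstance, linear := inferInstance, unit := υ, mul := μ,
            mul_assoc := ?_, unit_mul := ?_, mul_unit := ?_ },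
    ⟨{ θ := fun {x y} g => (E y).leftUnitor ≪≫ θ g, θ_unit := ?_, θ_mul := ?_ }⟩⟩
  · intro x y z t g h l gh hl ghl w₁ w₂ w₃ w₄ V
    apply (E t).map_injective
    have h₁ := a.mul_assoc g h l gh hl ghl w₁ w₂ w₃ w₄ ((E x).obj V)
    rw [← cancel_mono ((θ ghl).hom.app V)]
    simp only [Functor.map_comp, Category.assoc, Functor.id_map, Functor.id_obj]
    rw [hμ, hμ, reassoc_of% (hθ l ((μ g h gh w₁).hom.app V)), reassoc_of% (hμ h l hl w₂ V)]
    have h₂ := a.mul_naturality h l hl w₂ ((θ g).hom.app V)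
    simp only [Functor.comp_obj] at h₂
    rw [← Functor.map_comp_assoc, hμ, ← reassoc_of% h₂]
    simp only [Functor.map_comp, Category.assoc, h₁]
  · intro x y g V
    apply (E y).map_injective
    rw [← cancel_mono ((θ g).hom.app V), hμ, unit_mul, ← Functor.map_comp, ← hυ]
    exact (hθ _ _).symm
  · intro x y g V
    apply (E y).map_injective
    rw [← cancel_mono ((θ g).hom.app V), hμ, mul_unit]
    have h := a.unit_naturality y ((θ g).hom.app V)
    simp only [Functor.comp_obj] at h
    rw [h]
    simp [hυ]
  · intro x V
    simp [hυ]
  · intro x y z g h k w V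
    simpa using hμ g h k w V

end LinAction

/-! ### Arrows of the action groupoid -/

namespace ActionGroupoid

variable {Q : Type w} [Group Q] {I : Type u'} {ρ : Q →* Equiv.Perm I}

/-- The object of `Q ⋉ I` given by an element of `I`. -/
def of (i : I) : ActionGroupoid ρ :=
  letI := MulAction.compHom I ρ
  ActionCategory.objEquiv Q I i

/-- The arrow of `Q ⋉ I` with label `q`. -/
def homMk {i j : I} (q : Q) (h : ρ q i = j) : (of i : ActionGroupoid ρ) ⟶ of j := ⟨q, h⟩

theorem homMk_comp {i j l : I} {q r k : Q} (hq : ρ q i = j) (hr : ρ r j = l) (hk : ρ k i = l)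
    (w : r * q = k) : homMk q hq ≫ homMk r hr = homMk k hk :=
  Subtype.ext w

end ActionGroupoid

/-! ### Cancelling intertwiners from coherence diagrams of actions -/

section Diagrams

variable {C : Type u} [Category.{v} C]

/-- Here and below the `t` stand for components of `θ`. The objects and morphisms are left abstract,
so that the lemmas apply up to unfolding of restricted actions and of arrows of `Q ⋉ I`. -/
theorem isoUnit_of_comp {A B X Y : C} (t : A ≅ B) {η : B ⟶ X} {u' : X ⟶ Y} {u : B ⟶ Y}
    {t' : A ⟶ X} {e : A ⟶ Y} (h : t.hom ≫ η = t') (h₁ : t.hom ≫ u = e) (h₂ : t' ≫ u' = e) :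
    η ≫ u' = u := by
  rw [← cancel_epi t.hom, h₁, reassoc_of% h, h₂]

theorem isoMul_of_comp {F F' : C ⥤ C} (η : F ⟶ F') {X₁ X₁' X₂ X₂' Y Z W : C} (tg : Y ≅ X₁)
    (th : Z ≅ F.obj Y) {tg' : Y ⟶ X₁'} {th' : Z ⟶ F'.obj Y} {tk : W ⟶ X₂} {tk' : W ⟶ X₂'}
    {m : Z ⟶ W} {μ : F.obj X₁ ⟶ X₂} {μ' : F'.obj X₁' ⟶ X₂'} {ηg : X₁ ⟶ X₁'} {ηk : X₂ ⟶ X₂'}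
    (h₁ : m ≫ tk = th.hom ≫ F.map tg.hom ≫ μ) (h₂ : m ≫ tk' = th' ≫ F'.map tg' ≫ μ')
    (hg : tg.hom ≫ ηg = tg') (hh : th.hom ≫ η.app Y = th') (hk : tk ≫ ηk = tk') :
    μ ≫ ηk = F.map ηg ≫ η.app X₁' ≫ μ' := by
  subst hg hh hk
  rw [← cancel_epi (F.map tg.hom), ← cancel_epi th.hom]
  rw [reassoc_of% h₁] at h₂
  rw [h₂]
  simp

theorem comp_actMul {F : C ⥤ C} {X Y Z W V : C} (tg : Y ≅ X) (th : Z ≅ F.obj Y) (m : Z ⟶ W)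
    (tk : W ⟶ V) :
    m ≫ tk = th.hom ≫ F.map tg.hom ≫ F.map tg.inv ≫ th.inv ≫ m ≫ tk := by
  rw [← F.map_comp_assoc]
  simp

theorem actUnitMul_of_comp {F : C ⥤ C} {A₁ A₂ A₃ X Y : C} (t₁ : A₁ ≅ Y)
    (tg' : A₂ ≅ F.obj A₁) {tg : A₃ ⟶ F.obj X} {υ : Y ⟶ X} {μ : F.obj Y ⟶ F.obj X} {m : A₂ ⟶ A₃}
    {e : A₁ ⟶ X} (h₁ : m ≫ tg = tg'.hom ≫ F.map t₁.hom ≫ μ) (h₂ : m ≫ tg = tg'.hom ≫ F.map e)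
    (h₃ : t₁.hom ≫ υ = e) : μ = F.map υ := by
  rw [← cancel_epi (F.map t₁.hom), ← cancel_epi tg'.hom, ← h₁, h₂, ← h₃, F.map_comp]

theorem actMulUnit_of_comp {F : C ⥤ C} (υ : F ⟶ 𝟭 C) {A₁ A₂ X : C} (tg : A₁ ≅ X)
    (t₁ : A₂ ≅ F.obj A₁) {μ : F.obj X ⟶ X} {m : A₂ ⟶ A₁}
    (h₁ : m ≫ tg.hom = t₁.hom ≫ F.map tg.hom ≫ μ) (h₂ : t₁.hom ≫ υ.app A₁ = m) :
    μ = υ.app X := by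
  rw [← cancel_epi (F.map tg.hom), ← cancel_epi t₁.hom, ← h₁, ← h₂]
  simp

/-- Transfers associativity from `b` to `a`: `e₁`, `e₃`, `e₄`, `e₅` characterize the multiplication
of `a` on a summand, `e₂` is naturality of `θ`, and `e₆` is associativity of `b`. -/
theorem actAssoc_of_comp {Fh Fl Fhl : C ⥤ C} (μhl : Fh ⋙ Fl ⟶ Fhl)
    {X₁ X₂ X₃ Y₁ Y₂ Y₃ Y₄ Y₅ Y₆ Y₇ : C} (tg : Y₁ ≅ X₁) (th : Y₂ ≅ Fh.obj Y₁) (tl : Y₃ ≅ Fl.obj Y₂)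
    {tgh : Y₄ ⟶ X₂} {tl' : Y₅ ⟶ Fl.obj Y₄} {thl : Y₆ ⟶ Fhl.obj Y₁} {tghl : Y₇ ⟶ X₃}
    {mgh : Y₂ ⟶ Y₄} {lm : Y₃ ⟶ Y₅} {mghl : Y₅ ⟶ Y₇} {mhl : Y₃ ⟶ Y₆} {mghl' : Y₆ ⟶ Y₇}
    {μgh : Fh.obj X₁ ⟶ X₂} {μghl : Fl.obj X₂ ⟶ X₃} {μghl' : Fhl.obj X₁ ⟶ X₃}
    (e₁ : mgh ≫ tgh = th.hom ≫ Fh.map tg.hom ≫ μgh) (e₂ : lm ≫ tl' = tl.hom ≫ Fl.map mgh)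
    (e₃ : mghl ≫ tghl = tl' ≫ Fl.map tgh ≫ μghl)
    (e₄ : mhl ≫ thl = tl.hom ≫ Fl.map th.hom ≫ μhl.app Y₁)
    (e₅ : mghl' ≫ tghl = thl ≫ Fhl.map tg.hom ≫ μghl') (e₆ : lm ≫ mghl = mhl ≫ mghl') :
    Fl.map μgh ≫ μghl = μhl.app X₁ ≫ μghl' := by
  have e₇ := μhl.naturality tg.hom
  simp only [Functor.comp_map] at e₇
  rw [← cancel_epi (Fl.map (Fh.map tg.hom)), ← cancel_epi (Fl.map th.hom), ← cancel_epi tl.hom,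
    reassoc_of% e₇]
  calc _ = tl.hom ≫ Fl.map (mgh ≫ tgh) ≫ μghl := by rw [e₁]; simp
    _ = mhl ≫ mghl' ≫ tghl := by
      rw [← reassoc_of% e₆, e₃, reassoc_of% e₂]; simp
    _ = _ := by rw [e₅, reassoc_of% e₄]

end Diagrams

/-- Reduces a coherence law on `C` to the summands of the frame. Naturality is a separate hypothesis
because the two sides of such a law are given only as families of morphisms. -/
theorem IsFrame.app_ext {C : Type u} [Category.{v} C] [Preadditive C] [Linear ℂ C]
    {D : Type u'} [Category.{v'} D] [Preadditive D] {I : Type w} [Fintype I] {E : I → FdVec ⥤ C}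
    (hE : IsFrame E) {F G : C ⥤ D} [F.Additive] {f g : ∀ X, F.obj X ⟶ G.obj X}
    (hf : ∀ {X Y : C} (u : X ⟶ Y), F.map u ≫ f Y = f X ≫ G.map u)
    (hg : ∀ {X Y : C} (u : X ⟶ Y), F.map u ≫ g Y = g X ≫ G.map u)
    (h : ∀ (i : I) (V : FdVec), f ((E i).obj V) = g ((E i).obj V)) (X : C) : f X = g X :=
  hE.hom_ext F fun i V u => by rw [hf, hg, h]

/-! ### Actions of `Q` on `C` against actions of `Q ⋉ I` on `FdVec` -/

open ActionGroupoid

variable {Q : Type w} [Group Q] {I : Type u'} {ρ : Q →* Equiv.Perm I}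
  {C : Type u} [Category.{v} C] [Preadditive C] [Linear ℂ C]

namespace LinAction

variable (ρ) in
/-- An action of `Q` restricted to `Q ⋉ I`. -/
def restrict (a : GroupAction Q C) : LinAction (ActionGroupoid ρ) C where
  F g := a.F ((proj ρ).map g)
  additive g := a.additive _
  linear g := a.linear _
  unit x := a.unit ((proj ρ).obj x)
  mul g h k w := a.mul ((proj ρ).map g) ((proj ρ).map h) ((proj ρ).map k)
    (by rw [← w, Functor.map_comp])
  mul_assoc g h l gh hl ghl w₁ w₂ w₃ w₄ X := a.mul_assoc _ _ _ _ _ _ _ _ _ _ X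
  unit_mul g X := a.unit_mul _ X
  mul_unit g X := a.mul_unit _ X

/-- An isomorphism of actions of `Q` restricted to `Q ⋉ I`. -/
def ActionIso.restrict {a a' : GroupAction Q C} (e : ActionIso a a') :
    ActionIso (a.restrict ρ) (a'.restrict ρ) where
  η g := e.η ((proj ρ).map g)
  unit_η _ X := e.unit_η _ X
  mul_η _ _ _ _ X := e.mul_η _ _ _ _ X

namespace Intertwiner

variable [Fintype I] {E : I → FdVec ⥤ C}

/-- The action on the target is determined up to isomorphism by the action on the source. -/
theorem nonempty_actionIso (hE : IsFrame E) {a a' : GroupAction Q C}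
    {b : LinAction (ActionGroupoid ρ) FdVec}
    (T : Intertwiner (a.restrict ρ) b fun x => E x.pt)
    (T' : Intertwiner (a'.restrict ρ) b fun x => E x.pt) : Nonempty (ActionIso a a') := by
  have hA : ∀ q, (a.act q).Additive := fun q => a.additive _
  have hA' : ∀ q, (a'.act q).Additive := fun q => a'.additive _
  -- On the summand `i` the isomorphism is forced to be the inverse of `T.θ` followed by `T'.θ`.
  have h : ∀ (q : Q), ∃ η : a.act q ≅ a'.act q, ∀ (i j : I) (hq : ρ q i = j) (V : FdVec),
      (T.θ (homMk q hq)).hom.app V ≫ η.hom.app ((E i).obj V) =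
        (T'.θ (homMk q hq)).hom.app V := by
    intro q
    obtain ⟨η, hη⟩ := hE.exists_iso (F := a.act q) (G := a'.act q)
      fun i => (T.θ (homMk q rfl)).symm ≪≫ T'.θ (homMk q rfl)
    refine ⟨η, ?_⟩
    rintro i _ rfl V
    rw [hη]
    exact Iso.hom_inv_id_app_assoc (T.θ (homMk q rfl)) V _
  choose η hη using h
  refine ⟨⟨fun q => η q, fun x X => ?_, fun q r k w X => ?_⟩⟩
  · refine hE.app_ext (F := a.act 1) (G := 𝟭 C)
      (f := fun X => (η 1).hom.app X ≫ (a'.actOne X).hom) (g := fun X => (a.actOne X).hom)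
      (fun f => ?_) (fun f => a.unit_naturality _ f) (fun i V => ?_) X
    · rw [← Category.assoc, (η 1).hom.naturality, Category.assoc, Category.assoc]
      exact congrArg _ (a'.unit_naturality _ f)
    · exact isoUnit_of_comp ((T.θ (homMk (1 : Q) (by simp : ρ 1 i = i))).app V)
        (hη 1 i i _ V) (T.θ_unit (of i) V) (T'.θ_unit (of i) V)
  · refine hE.app_ext (F := a.act q ⋙ a.act r) (G := a'.act k)
      (f := fun X => (a.mul q r k w).hom.app X ≫ (η k).hom.app X)
      (g := fun X => (a.act r).map ((η q).hom.app X) ≫ (η r).hom.app ((a'.act q).obj X) ≫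
        (a'.mul q r k w).hom.app X) (fun f => ?_) (fun f => ?_) (fun i V => ?_) X
    · exact ((a.mul q r k w).hom ≫ (η k).hom).naturality f
    · have := ((Functor.whiskerRight (η q).hom (a.act r)) ≫
        (Functor.whiskerLeft (a'.act q) (η r).hom) ≫ (a'.mul q r k w).hom).naturality f
      exact this
    · have w' : (homMk q rfl ≫ homMk r rfl : (of i : ActionGroupoid ρ) ⟶ _) =
        homMk k (by rw [← w]; exact congrFun (congrArg _ (ρ.map_mul r q)) i) := homMk_comp _ _ _ w
      exact isoMul_of_comp (η r).hom ((T.θ (homMk q rfl)).app V) ((T.θ (homMk r rfl)).app _)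
        (T.θ_mul _ _ _ w' V) (T'.θ_mul _ _ _ w' V) (hη q _ _ _ V) (hη r _ _ _ _) (hη k _ _ _ _)

end Intertwiner

/-- Exactly one arrow with label `q` starts at each `i`, so `b` prescribes `a_q` on every summand:
`E i V` goes to `E (ρ q i)` of `b_g V`. The intertwiner laws then dictate the unit and
multiplication on the summands, and their axioms follow from those of `b`. -/
theorem exists_intertwiner_target [Fintype I] {E : I → FdVec ⥤ C} (hE : IsFrame E)
    (hB : ∀ Y : I → C, Limits.HasBiproduct Y) (b : LinAction (ActionGroupoid ρ) FdVec) :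
    ∃ a : GroupAction Q C, Nonempty (Intertwiner (a.restrict ρ) b fun x => E x.pt) := by
  have hEA := hE.additive
  have hEL := hE.linear
  have h : ∀ q : Q, ∃ F : C ⥤ C, F.Additive ∧ F.Linear ℂ ∧ ∀ (x y : ActionGroupoid ρ)
      (g : x ⟶ y), g.val = q → Nonempty (b.F g ⋙ E y.pt ≅ E x.pt ⋙ F) := by
    intro q
    obtain ⟨F, hA, hL, hF⟩ := hE.exists_functor hB
      (fun i => b.F (homMk q (rfl : ρ q i = ρ q i)) ⋙ E (ρ q i))
      (fun i => inferInstance) (fun i => inferInstance)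
    refine ⟨F, hA, hL, ?_⟩
    have key : ∀ (i j : I) (h : ρ q i = j), Nonempty (b.F (homMk q h) ⋙ E j ≅ E i ⋙ F) := by
      rintro i _ rfl
      exact ⟨(hF i).some.symm⟩
    rintro x y g rfl
    exact key x.pt y.pt g.2
  choose F hFA hFL hF using h
  let θ : ∀ {x y : ActionGroupoid ρ} (g : x ⟶ y), b.F g ⋙ E y.pt ≅ E x.pt ⋙ F g.val :=
    fun {x y} g => (hF g.val x y g rfl).some
  have hυ : ∃ υ : F 1 ≅ 𝟭 C, ∀ (x : ActionGroupoid ρ) (V : FdVec),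
      (θ (𝟙 x)).hom.app V ≫ υ.hom.app ((E x.pt).obj V) = (E x.pt).map ((b.unit x).hom.app V) := by
    obtain ⟨υ, hυ⟩ := hE.exists_iso (F := F 1) (G := 𝟭 C)
      fun i => (θ (𝟙 (of i))).symm ≪≫ Functor.isoWhiskerRight (b.unit (of i)) (E i)
    refine ⟨υ, fun x V => ?_⟩
    have h := hυ x.pt V
    refine (congrArg ((θ (𝟙 x)).hom.app V ≫ ·) h).trans ?_
    exact Iso.hom_inv_id_app_assoc (θ (𝟙 x)) V _
  obtain ⟨υ, hυ⟩ := hυ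
  -- The endpoints `j`, `l` are variables, not `ρ q i` and `ρ r (ρ q i)`, so that the equation
  -- applies to all composable arrows without casts.
  have hμ : ∀ q r k : Q, r * q = k → ∃ μ : F q ⋙ F r ≅ F k,
      ∀ (i j l : I) (hq : ρ q i = j) (hr : ρ r j = l) (hk : ρ k i = l)
        (w : homMk q hq ≫ homMk r hr = homMk k hk) (V : FdVec),
        (E l).map ((b.mul _ _ _ w).hom.app V) ≫ (θ (homMk k hk)).hom.app V =
          (θ (homMk r hr)).hom.app ((b.F (homMk q hq)).obj V) ≫
            (F r).map ((θ (homMk q hq)).hom.app V) ≫ μ.hom.app ((E i).obj V) := by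
    rintro q r k hqr
    have hk : ∀ i, ρ k i = ρ r (ρ q i) := fun i => by rw [← hqr, map_mul]; rfl
    obtain ⟨μ, hμ⟩ := hE.exists_iso (F := F q ⋙ F r) (G := F k) fun i =>
      Functor.isoWhiskerRight (θ (homMk q (rfl : ρ q i = ρ q i))).symm (F r) ≪≫
        Functor.isoWhiskerLeft (b.F (homMk q rfl)) (θ (homMk r rfl)).symm ≪≫
        Functor.isoWhiskerRight (b.mul _ _ _ (homMk_comp rfl rfl (hk i) hqr)) (E _) ≪≫
        θ (homMk k (hk i))
    refine ⟨μ, ?_⟩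
    rintro i _ _ rfl rfl hk' w V
    rw [hμ]
    exact comp_actMul ((θ (homMk q rfl)).app V) ((θ (homMk r rfl)).app _) _ _
  choose μ hμ using hμ
  have hw : ∀ {i : I} {q r k : Q} (_ : r * q = k), ρ k i = ρ r (ρ q i) :=
    fun h => by rw [← h, map_mul]; rfl
  let a : GroupAction Q C :=
    { F := fun q => F q
      additive := fun q => hFA q
      linear := fun q => hFL q
      unit := fun x => υ
      mul := fun q r k w => μ q r k w
      mul_assoc := fun q r l qr rl qrl w₁ w₂ w₃ w₄ X => by
        refine hE.app_ext (F := (F q ⋙ F r) ⋙ F l) (G := F qrl)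
          (f := fun X => (F l).map ((μ q r qr w₁).hom.app X) ≫ (μ qr l qrl w₃).hom.app X)
          (g := fun X => (μ r l rl w₂).hom.app ((F q).obj X) ≫ (μ q rl qrl w₄).hom.app X)
          (fun f => ?_) (fun f => ?_) (fun i V => ?_) X
        · exact (Functor.whiskerRight (μ q r qr w₁).hom (F l) ≫
            (μ qr l qrl w₃).hom).naturality f
        · exact (Functor.whiskerLeft (F q) (μ r l rl w₂).hom ≫ (μ q rl qrl w₄).hom).naturality f
        · let g : (of i : ActionGroupoid ρ) ⟶ of (ρ q i) := homMk q rfl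
          let h : (of (ρ q i) : ActionGroupoid ρ) ⟶ of (ρ r (ρ q i)) := homMk r rfl
          let l' : (of (ρ r (ρ q i)) : ActionGroupoid ρ) ⟶ of (ρ l (ρ r (ρ q i))) := homMk l rfl
          have w₁' : g ≫ h = homMk qr (hw w₁) := homMk_comp _ _ _ w₁
          have w₂' : h ≫ l' = homMk rl (hw w₂) := homMk_comp _ _ _ w₂
          have w₃' : homMk qr (hw w₁) ≫ l' = homMk qrl ((hw w₃).trans (by rw [hw w₁])) :=
            homMk_comp _ _ _ w₃
          have w₄' : g ≫ homMk rl (hw w₂) = homMk qrl ((hw w₃).trans (by rw [hw w₁])) :=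
            homMk_comp _ _ _ w₄
          exact actAssoc_of_comp (μ r l rl w₂).hom ((θ g).app V) ((θ h).app _) ((θ l').app _)
            (hμ _ _ _ w₁ _ _ _ _ _ _ w₁' V)
            ((θ l').hom.naturality ((b.mul _ _ _ w₁').hom.app V))
            (hμ _ _ _ w₃ _ _ _ _ _ _ w₃' V)
            (hμ _ _ _ w₂ _ _ _ _ _ _ w₂' _)
            (hμ _ _ _ w₄ _ _ _ _ _ _ w₄' V)
            (((E _).map_comp _ _).symm.trans
              ((congrArg (E _).map (b.mul_assoc _ _ _ _ _ _ w₁' w₂' w₃' w₄' V)).trans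
                ((E _).map_comp _ _)))
      unit_mul := fun q X => by
        refine hE.app_ext (F := F 1 ⋙ F q) (G := F q)
          (f := fun X => (μ 1 q q (mul_one q)).hom.app X) (g := fun X => (F q).map (υ.hom.app X))
          (fun f => (μ 1 q q (mul_one q)).hom.naturality f)
          (fun f => (Functor.whiskerRight υ.hom (F q)).naturality f) (fun i V => ?_) X
        let g : (of i : ActionGroupoid ρ) ⟶ of (ρ q i) := homMk q rfl
        have h₁ := hμ 1 q q (mul_one q) _ _ _ (by simp) rfl rfl (Category.id_comp g) V
        exact actUnitMul_of_comp ((θ (𝟙 (of i))).app V) ((θ g).app _) h₁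
          ((congrArg (fun t => (E (ρ q i)).map t ≫ (θ g).hom.app V) (b.unit_mul g V)).trans
            ((θ g).hom.naturality _)) (hυ (of i) V)
      mul_unit := fun q X => by
        refine hE.app_ext (F := F q ⋙ F 1) (G := F q)
          (f := fun X => (μ q 1 q (one_mul q)).hom.app X) (g := fun X => υ.hom.app ((F q).obj X))
          (fun f => (μ q 1 q (one_mul q)).hom.naturality f)
          (fun f => (Functor.whiskerLeft (F q) υ.hom).naturality f) (fun i V => ?_) X
        let g : (of i : ActionGroupoid ρ) ⟶ of (ρ q i) := homMk q rfl
        have h₁ := hμ q 1 q (one_mul q) _ _ _ rfl (by simp) rfl (Category.comp_id g) V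
        exact actMulUnit_of_comp υ.hom ((θ g).app V) ((θ (𝟙 (of (ρ q i)))).app _) h₁
          ((hυ _ _).trans (congrArg (E (ρ q i)).map (b.mul_unit g V)).symm) }
  refine ⟨a, ⟨{ θ := θ, θ_unit := hυ, θ_mul := fun g h k w V => ?_ }⟩⟩
  exact hμ _ _ _ (congrArg Subtype.val w) _ _ _ g.2 h.2 k.2 w V

end LinAction

/-! ### Cancelling intertwiners from diagrams of equivariant objects -/

section Diagrams

variable {C : Type u} [Category.{v} C]

/-- An equivalence, since it is used both to assemble equivariant data in `C` and to extract it; in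
the second use the trailing `j'` is cancelled as a monomorphism. The next two lemmas serve the unit
and multiplication laws likewise. -/
theorem equivariant_iff_of_comp {F : C ⥤ C} {A A' B B' X X' Y Y' : C} (t : Y ≅ F.obj A)
    {t' : Y' ⟶ F.obj A'} {i : A ⟶ X} {i' : A' ⟶ X'} {j : B ⟶ X} {j' : B' ⟶ X'} {p : Y ⟶ B}
    {p' : Y' ⟶ B'} {φ : F.obj X ⟶ X} {φ' : F.obj X' ⟶ X'} {m : X ⟶ X'} {e : A ⟶ A'} {eY : Y ⟶ Y'}
    {eB : B ⟶ B'} (h : t.hom ≫ F.map i ≫ φ = p ≫ j) (h' : t' ≫ F.map i' ≫ φ' = p' ≫ j')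
    (hn : eY ≫ t' = t.hom ≫ F.map e) (hi : i ≫ m = e ≫ i') (hj : j ≫ m = eB ≫ j') :
    F.map i ≫ φ ≫ m = F.map i ≫ F.map m ≫ φ' ↔ (p ≫ eB) ≫ j' = (eY ≫ p') ≫ j' := by
  have h₁ : (p ≫ eB) ≫ j' = t.hom ≫ F.map i ≫ φ ≫ m := by
    rw [Category.assoc, ← hj, ← reassoc_of% h]
  have h₂ : (eY ≫ p') ≫ j' = t.hom ≫ F.map i ≫ F.map m ≫ φ' := by
    rw [Category.assoc, ← h', reassoc_of% hn, ← F.map_comp_assoc, ← F.map_comp_assoc, hi]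
  rw [h₁, h₂, cancel_epi t.hom]

theorem unit_iff_of_comp {F : C ⥤ C} (υ : F ⟶ 𝟭 C) {A X Y : C} (t : Y ≅ F.obj A) {i : A ⟶ X}
    {p e : Y ⟶ A} {φ : F.obj X ⟶ X} (h : t.hom ≫ F.map i ≫ φ = p ≫ i)
    (he : t.hom ≫ υ.app A = e) :
    F.map i ≫ φ = F.map i ≫ υ.app X ↔ p ≫ i = e ≫ i := by
  rw [← h, ← he, ← cancel_epi t.hom]
  simp

theorem mul_iff_of_comp {F F' F'' : C ⥤ C} (μ : F ⋙ F' ⟶ F'') {A B D X Y Y' Z W : C}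
    (tg : Y ≅ F.obj A) (th : Z ≅ F'.obj Y) {th' : Y' ⟶ F'.obj B} {tk : W ⟶ F''.obj A}
    {m : Z ⟶ W} {pg : Y ⟶ B} {ph : Y' ⟶ D} {pk : W ⟶ D} {bp : Z ⟶ Y'} {i : A ⟶ X} {j : B ⟶ X}
    {l : D ⟶ X} {φ : F.obj X ⟶ X} {φ' : F'.obj X ⟶ X} {φ'' : F''.obj X ⟶ X}
    (h : m ≫ tk = th.hom ≫ F'.map tg.hom ≫ μ.app A) (hg : tg.hom ≫ F.map i ≫ φ = pg ≫ j)
    (hh : th' ≫ F'.map j ≫ φ' = ph ≫ l) (hk : tk ≫ F''.map i ≫ φ'' = pk ≫ l)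
    (hn : bp ≫ th' = th.hom ≫ F'.map pg) :
    (F ⋙ F').map i ≫ μ.app X ≫ φ'' = (F ⋙ F').map i ≫ F'.map φ ≫ φ' ↔
      (m ≫ pk) ≫ l = (bp ≫ ph) ≫ l := by
  have h₁ : (m ≫ pk) ≫ l = th.hom ≫ F'.map tg.hom ≫ (F ⋙ F').map i ≫ μ.app X ≫ φ'' := by
    rw [Category.assoc, ← hk, reassoc_of% h, μ.naturality_assoc]
  have h₂ : (bp ≫ ph) ≫ l = th.hom ≫ F'.map tg.hom ≫ (F ⋙ F').map i ≫ F'.map φ ≫ φ' := by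
    rw [Category.assoc, ← hh, reassoc_of% hn, ← F'.map_comp_assoc, ← hg]
    simp
  rw [h₁, h₂, cancel_epi th.hom, cancel_epi (F'.map tg.hom)]

theorem map_comp_sum_eq [Preadditive C] {F : C ⥤ C} [F.Additive] {I : Type w} [Fintype I]
    {Y : I → C} {X Z : C} {ι : ∀ i, Y i ⟶ X} {π : ∀ i, X ⟶ Y i} (h : ∀ i, ι i ≫ π i = 𝟙 _)
    (h' : ∀ i j, i ≠ j → ι i ≫ π j = 0) (r : ∀ i, F.obj (Y i) ⟶ Z) (i : I) :
    F.map (ι i) ≫ ∑ j, F.map (π j) ≫ r j = r i := by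
  rw [Preadditive.comp_sum, Finset.sum_eq_single i]
  · rw [← F.map_comp_assoc, h, F.map_id, Category.id_comp]
  · intro j _ hji
    rw [← F.map_comp_assoc, h' i j hji.symm, F.map_zero, Limits.zero_comp]
  · simp

end Diagrams

/-! ### Comparison of the categories of invariants -/

namespace LinAction

section

variable {G : Type u₁} [Groupoid.{v₁} G]
  {D : Type u} [Category.{v} D] [Preadditive D] [Linear ℂ D]

/-- Invertibility is automatic: coherence for `g`, `g⁻¹` makes `g⁻¹ · φ g` followed by `φ g⁻¹`
invertible, so `φ g` is mono; coherence for `g⁻¹`, `g` gives it a section. -/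
theorem isIso_of_coherent (a : LinAction G D) {X : G → D}
    (φ : ∀ {x y : G} (g : x ⟶ y), (a.F g).obj (X x) ⟶ X y)
    (φ_unit : ∀ x, φ (𝟙 x) = (a.unit x).hom.app (X x))
    (φ_mul : ∀ {x y z : G} (g : x ⟶ y) (h : y ⟶ z) (k : x ⟶ z) (w : g ≫ h = k),
      (a.mul g h k w).hom.app (X x) ≫ φ k = (a.F h).map (φ g) ≫ φ h)
    {x y : G} (g : x ⟶ y) : IsIso (φ g) := by
  have h₁ := φ_mul g (Groupoid.inv g) (𝟙 x) (Groupoid.comp_inv g)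
  have h₂ := φ_mul (Groupoid.inv g) g (𝟙 y) (Groupoid.inv_comp g)
  rw [φ_unit] at h₁ h₂
  have : (a.F (Groupoid.inv g)).IsEquivalence := a.isEquivalence _
  have : Mono ((a.F (Groupoid.inv g)).map (φ g)) := by
    have : Mono ((a.F (Groupoid.inv g)).map (φ g) ≫ φ (Groupoid.inv g)) := by
      rw [← h₁]
      infer_instance
    exact mono_of_mono _ (φ (Groupoid.inv g))
  have : Mono (φ g) := (a.F (Groupoid.inv g)).mono_of_mono_map this
  have : IsSplitEpi (φ g) := by
    refine ⟨⟨inv ((a.mul (Groupoid.inv g) g (𝟙 y) (Groupoid.inv_comp g)).hom.app (X y) ≫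
      (a.unit y).hom.app (X y)) ≫ (a.F g).map (φ (Groupoid.inv g)), ?_⟩⟩
    rw [Category.assoc, ← h₂, IsIso.inv_hom_id]
  exact isIso_of_mono_of_isSplitEpi (φ g)

end

open ActionGroupoid

variable {Q : Type w} [Group Q] {I : Type u'} [Fintype I] {ρ : Q →* Equiv.Perm I}
  {C : Type u} [Category.{v} C] [Preadditive C] [Linear ℂ C]
  {E : I → FdVec ⥤ C} {a : GroupAction Q C} {b : LinAction (ActionGroupoid ρ) FdVec}

/-- The structure isomorphism `q · M ≅ M` of an equivariant object of `C`. -/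
def Invariants.actIso (M : a.Invariants) (q : Q) :
    (a.act q).obj (M.obj (SingleObj.star Q)) ≅ M.obj (SingleObj.star Q) :=
  M.φ (show SingleObj.star Q ⟶ SingleObj.star Q from q)

/-- A decomposition of an equivariant object of `C` along an equivariant object of `FdVec`. -/
structure Assembly (T : Intertwiner (a.restrict ρ) b fun x => E x.pt) (N : b.Invariants)
    (M : a.Invariants) where
  ι (i : I) : (E i).obj (N.obj (of i)) ⟶ M.obj (SingleObj.star Q)
  π (i : I) : M.obj (SingleObj.star Q) ⟶ (E i).obj (N.obj (of i))
  ι_π (i : I) : ι i ≫ π i = 𝟙 _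
  total : ∑ i, π i ≫ ι i = 𝟙 _
  comm {i j : I} (q : Q) (h : ρ q i = j) :
    (T.θ (homMk q h)).hom.app (N.obj (of i)) ≫ (a.act q).map (ι i) ≫ (M.actIso q).hom =
      (E j).map (N.φ (homMk q h)).hom ≫ ι j

theorem Assembly.hom_ext {T : Intertwiner (a.restrict ρ) b fun x => E x.pt} {N : b.Invariants}
    {M : a.Invariants} (A : Assembly T N M) (F : C ⥤ C) [F.Additive] {X : C}
    {f g : F.obj (M.obj (SingleObj.star Q)) ⟶ X}
    (h : ∀ i, F.map (A.ι i) ≫ f = F.map (A.ι i) ≫ g) : f = g := by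
  rw [← Category.id_comp f, ← Category.id_comp g, ← F.map_id, ← A.total, F.map_sum,
    Preadditive.sum_comp, Preadditive.sum_comp]
  simp only [F.map_comp, Category.assoc, h]

theorem Assembly.mono {T : Intertwiner (a.restrict ρ) b fun x => E x.pt} {N : b.Invariants}
    {M : a.Invariants} (A : Assembly T N M) (i : I) : Mono (A.ι i) :=
  (SplitMono.mk (A.π i) (A.ι_π i)).mono

variable {T : Intertwiner (a.restrict ρ) b fun x => E x.pt}

instance (q : Q) : (a.act q).Additive := a.additive _

/-- `M` is the sum of the `E i (N i)`, and `q` maps the summand `i` to the summand `ρ q i` by the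
inverse of `θ` followed by the structure map of `N`. -/
theorem exists_assembly_target (hB : ∀ Y : I → C, Limits.HasBiproduct Y)
    (T : Intertwiner (a.restrict ρ) b fun x => E x.pt) (N : b.Invariants) :
    ∃ M : a.Invariants, Nonempty (Assembly T N M) := by
  classical
  let V : I → FdVec := fun i => N.obj (of i)
  have : Limits.HasBiproduct fun i => (E i).obj (V i) := hB _
  obtain ⟨X, ι, π, hιπ, hιπ', hX⟩ : ∃ (X : C) (ι : ∀ i, (E i).obj (V i) ⟶ X)
      (π : ∀ i, X ⟶ (E i).obj (V i)), (∀ i, ι i ≫ π i = 𝟙 _) ∧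
        (∀ i j, i ≠ j → ι i ≫ π j = 0) ∧ ∑ i, π i ≫ ι i = 𝟙 X :=
    ⟨Limits.biproduct fun i => (E i).obj (V i), Limits.biproduct.ι _, Limits.biproduct.π _,
      fun i => by simp, fun i j h => Limits.biproduct.ι_π_ne _ h,
      Limits.IsBilimit.total (Limits.biproduct.isBilimit _)⟩
  have hext : ∀ (F : C ⥤ C) [F.Additive] {Z : C} {f g : F.obj X ⟶ Z},
      (∀ i, F.map (ι i) ≫ f = F.map (ι i) ≫ g) → f = g := by
    intro F _ Z f g h
    rw [← Category.id_comp f, ← Category.id_comp g, ← F.map_id, ← hX, F.map_sum,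
      Preadditive.sum_comp, Preadditive.sum_comp]
    simp only [F.map_comp, Category.assoc, h]
  let r : ∀ (q : Q) (i : I), (a.act q).obj ((E i).obj (V i)) ⟶ X := fun q i =>
    ((T.θ (homMk q (rfl : ρ q i = ρ q i))).app (V i)).inv ≫
      (E (ρ q i)).map (N.φ (homMk q rfl)).hom ≫ ι (ρ q i)
  let φ : ∀ q : Q, (a.act q).obj X ⟶ X := fun q => ∑ i, (a.act q).map (π i) ≫ r q i
  have hφ : ∀ {i j : I} (q : Q) (h : ρ q i = j), ((T.θ (homMk q h)).app (V i)).hom ≫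
      (a.act q).map (ι i) ≫ φ q = (E j).map (N.φ (homMk q h)).hom ≫ ι j := by
    rintro i _ q rfl
    refine (congrArg (((T.θ (homMk q (rfl : ρ q i = ρ q i))).app (V i)).hom ≫ ·)
      (map_comp_sum_eq hιπ hιπ' (r q) i)).trans ?_
    exact Iso.hom_inv_id_assoc _ _
  have φ_unit : φ 1 = (a.actOne X).hom := by
    refine hext (a.act 1) fun i => ?_
    refine (unit_iff_of_comp (a.unit (SingleObj.star Q)).hom _
      (hφ 1 (by simp : ρ 1 i = i)) (T.θ_unit (of i) _)).mpr ?_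
    exact congrArg (fun t => (E i).map t ≫ ι i) (N.φ_unit (of i))
  have φ_mul : ∀ q r k (w : r * q = k), (a.mul (show SingleObj.star Q ⟶ SingleObj.star Q from q)
      (show SingleObj.star Q ⟶ SingleObj.star Q from r) k w).hom.app X ≫ φ k =
        (a.act r).map (φ q) ≫ φ r := by
    intro q r k w
    refine hext (a.act q ⋙ a.act r) fun i => ?_
    have hk : ρ k i = ρ r (ρ q i) := by rw [← w, map_mul]; rfl
    have w' : (homMk q rfl ≫ homMk r rfl : (of i : ActionGroupoid ρ) ⟶ _) = homMk k hk :=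
      homMk_comp _ _ _ w
    refine (mul_iff_of_comp (a.mul (show SingleObj.star Q ⟶ SingleObj.star Q from q)
      (show SingleObj.star Q ⟶ SingleObj.star Q from r) k w).hom _ ((T.θ (homMk r rfl)).app _)
      (T.θ_mul _ _ _ w' (V i)) (hφ q rfl) (hφ r rfl) (hφ k hk)
      (T.θ_naturality (homMk r rfl) (N.φ (homMk q rfl)).hom)).mpr ?_
    have h := congrArg (fun t => (E (ρ r (ρ q i))).map t ≫ ι _) (N.φ_mul _ _ _ w')
    simp only [Functor.map_comp] at h
    exact h
  have hiso : ∀ q, IsIso (φ q) := fun q =>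
    isIso_of_coherent a (X := fun _ => X) (fun q => φ q) (fun _ => φ_unit)
      (fun q r k w => φ_mul q r k w) (show SingleObj.star Q ⟶ SingleObj.star Q from q)
  let M : a.Invariants :=
    { obj := fun _ => X
      φ := fun q => @asIso _ _ _ _ (φ q) (hiso q)
      φ_unit := fun _ => φ_unit
      φ_mul := fun q r k w => φ_mul q r k w }
  exact ⟨M, ⟨{ ι := ι, π := π, ι_π := hιπ, total := hX, comm := hφ }⟩⟩

/-- `N i` is the multiplicity space of `M`. A map from `E j W` to `M` factors through the summand
`j` by orthogonality, so the structure of `M`, transported by `θ`, descends to the multiplicity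
spaces; its laws descend because each `ι j` is mono. -/
theorem exists_assembly_source (hE : IsFrame E)
    (T : Intertwiner (a.restrict ρ) b fun x => E x.pt) (M : a.Invariants) :
    ∃ N : b.Invariants, Nonempty (Assembly T N M) := by
  have hfull := hE.full
  have hfaith := hE.faithful
  obtain ⟨V, ι, π, hιπ, hX⟩ := hE.exists_decomposition (M.obj (SingleObj.star Q))
  have hmono : ∀ i, Mono (ι i) := fun i => (SplitMono.mk (π i) (hιπ i)).mono
  have hlift : ∀ {i : I} {W : FdVec} (u : (E i).obj W ⟶ M.obj (SingleObj.star Q)),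
      ∃ ψ : W ⟶ V i, (E i).map ψ ≫ ι i = u := by
    intro i W u
    refine ⟨(E i).preimage (u ≫ π i), ?_⟩
    conv_rhs => rw [← Category.comp_id u, ← hX, Preadditive.comp_sum]
    rw [Finset.sum_eq_single i]
    · simp
    · intro j _ hji
      have h0 : u ≫ π j = 0 := hE.orthogonal hji.symm _
      rw [reassoc_of% h0, Limits.zero_comp]
    · simp
  choose ψ hψ using fun {x y : ActionGroupoid ρ} (g : x ⟶ y) =>
    hlift (((T.θ g).app (V x.pt)).hom ≫ (a.act g.val).map (ι x.pt) ≫ (M.actIso g.val).hom)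
  have ψ_unit : ∀ x, ψ (𝟙 x) = (b.unit x).hom.app (V x.pt) := by
    intro x
    apply (E x.pt).map_injective
    rw [← cancel_mono (ι x.pt)]
    refine (unit_iff_of_comp (a.unit (SingleObj.star Q)).hom _ (hψ (𝟙 x)).symm
      (T.θ_unit x _)).mp ?_
    exact congrArg _ (M.φ_unit (SingleObj.star Q))
  have ψ_mul : ∀ {x y z : ActionGroupoid ρ} (g : x ⟶ y) (h : y ⟶ z) (k : x ⟶ z) (w : g ≫ h = k),
      (b.mul g h k w).hom.app (V x.pt) ≫ ψ k = (b.F h).map (ψ g) ≫ ψ h := by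
    intro x y z g h k w
    apply (E z.pt).map_injective
    rw [← cancel_mono (ι z.pt), Functor.map_comp, Functor.map_comp]
    refine (mul_iff_of_comp ((a.restrict ρ).mul g h k w).hom _ ((T.θ h).app _)
      (T.θ_mul _ _ _ w (V x.pt)) (hψ g).symm (hψ h).symm (hψ k).symm
      (T.θ_naturality h (ψ g))).mp ?_
    exact congrArg _ (M.φ_mul _ _ _ (congrArg Subtype.val w))
  have hiso : ∀ {x y : ActionGroupoid ρ} (g : x ⟶ y), IsIso (ψ g) := fun g =>
    isIso_of_coherent b (X := fun x => V x.pt) ψ ψ_unit ψ_mul g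
  let N : b.Invariants :=
    { obj := fun x => V x.pt
      φ := fun g => @asIso _ _ _ _ (ψ g) (hiso g)
      φ_unit := ψ_unit
      φ_mul := ψ_mul }
  exact ⟨N, ⟨{ ι := ι, π := π, ι_π := hιπ, total := hX, comm := fun q h => (hψ (homMk q h)).symm }⟩⟩

namespace Assembly

variable {N N' : b.Invariants} {M M' : a.Invariants}

theorem exists_hom (A : Assembly T N M) (A' : Assembly T N' M') (hE : IsFrame E) (f : N ⟶ N') :
    ∃ m : M ⟶ M', ∀ i, A.ι i ≫ m.app (SingleObj.star Q) = (E i).map (f.app (of i)) ≫ A'.ι i := by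
  have := hE.additive
  let m : M.obj (SingleObj.star Q) ⟶ M'.obj (SingleObj.star Q) :=
    ∑ i, A.π i ≫ (E i).map (f.app (of i)) ≫ A'.ι i
  have hm : ∀ i, A.ι i ≫ m = (E i).map (f.app (of i)) ≫ A'.ι i := by
    intro i
    rw [Preadditive.comp_sum, Finset.sum_eq_single i]
    · rw [reassoc_of% A.ι_π]
    · intro j _ hji
      have h0 : A.ι i ≫ A.π j = 0 := hE.orthogonal hji.symm _
      rw [reassoc_of% h0, Limits.zero_comp]
    · simp
  have hcomm : ∀ q, (M.actIso q).hom ≫ m = (a.act q).map m ≫ (M'.actIso q).hom := by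
    intro q
    refine A.hom_ext (a.act q) fun i => ?_
    refine (equivariant_iff_of_comp ((T.θ (homMk q (rfl : ρ q i = ρ q i))).app _)
      (A.comm q rfl) (A'.comm q rfl) (T.θ_naturality (homMk q rfl) (f.app (of i)))
      (hm i) (hm _)).mpr ?_
    have h := congrArg (fun t => (E (ρ q i)).map t ≫ A'.ι _) (f.comm (homMk q rfl))
    simp only [Functor.map_comp] at h
    exact h
  exact ⟨{ app := fun _ => m, comm := fun q => hcomm q }, hm⟩

theorem hom_unique (A : Assembly T N M) {m m' : M ⟶ M'}
    (h : ∀ i, A.ι i ≫ m.app (SingleObj.star Q) = A.ι i ≫ m'.app (SingleObj.star Q)) : m = m' :=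
  Invariants.hom_ext fun _ => A.hom_ext (𝟭 C) h

theorem exists_hom_source (A : Assembly T N M) (A' : Assembly T N' M') (hE : IsFrame E)
    (m : M ⟶ M') :
    ∃ f : N ⟶ N', ∀ i,
      A.ι i ≫ m.app (SingleObj.star Q) = (E i).map (f.app (of i)) ≫ A'.ι i := by
  have hfull := hE.full
  have hfaith := hE.faithful
  have h : ∀ i, ∃ f : N.obj (of i) ⟶ N'.obj (of i),
      A.ι i ≫ m.app (SingleObj.star Q) = (E i).map f ≫ A'.ι i := by
    intro i
    refine ⟨(E i).preimage (A.ι i ≫ m.app (SingleObj.star Q) ≫ A'.π i), ?_⟩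
    conv_lhs => rw [← Category.comp_id (m.app _), ← A'.total, Preadditive.comp_sum,
      Preadditive.comp_sum]
    rw [Finset.sum_eq_single i]
    · simp
    · intro j _ hji
      have h0 : A.ι i ≫ m.app (SingleObj.star Q) ≫ A'.π j = 0 := hE.orthogonal hji.symm _
      rw [reassoc_of% h0, Limits.zero_comp]
    · simp
  choose f hf using h
  refine ⟨{ app := fun x => f x.pt, comm := fun {x y} g => ?_ }, hf⟩
  have := A'.mono y.pt
  apply (E y.pt).map_injective
  refine (cancel_mono (A'.ι y.pt)).mp ?_
  refine (congrArg (· ≫ A'.ι y.pt) ((E y.pt).map_comp _ _)).trans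
    (Eq.trans ?_ (congrArg (· ≫ A'.ι y.pt) ((E y.pt).map_comp _ _)).symm)
  refine (equivariant_iff_of_comp ((T.θ g).app _) (A.comm g.val g.2) (A'.comm g.val g.2)
    (T.θ_naturality g (f x.pt)) (hf _) (hf _)).mp ?_
  exact congrArg _ (m.comm _)

end Assembly

theorem linearlyEquivalent_invariants (hE : IsFrame E) (hB : ∀ Y : I → C, Limits.HasBiproduct Y)
    (T : Intertwiner (a.restrict ρ) b fun x => E x.pt) :
    LinearlyEquivalent a.Invariants b.Invariants := by
  have hEA := hE.additive
  have hEL := hE.linear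
  have hfull := hE.full
  have hfaith := hE.faithful
  choose M hM using exists_assembly_target hB T
  let A : ∀ N, Assembly T N (M N) := fun N => (hM N).some
  choose m hm using fun {N N' : b.Invariants} (f : N ⟶ N') => (A N).exists_hom (A N') hE f
  let K : b.Invariants ⥤ a.Invariants :=
    { obj := M
      map := m
      map_id := fun N => (A N).hom_unique fun i => by simp [hm]
      map_comp := fun {N N' N''} f g => (A N).hom_unique fun i => by
        rw [hm, Invariants.comp_app, Invariants.comp_app, reassoc_of% hm, hm]
        simp }
  have hKA : K.Additive := ⟨fun {N N' f g} => (A N).hom_unique fun i => by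
    simp [K, hm, Functor.map_add]⟩
  have hKL : K.Linear ℂ := ⟨fun {N N'} f r => (A N).hom_unique fun i => by
    simp [K, hm, Functor.map_smul]⟩
  have hKf : K.Faithful := ⟨fun {N N' f g} h => Invariants.hom_ext fun x => by
    have := (A N').mono x.pt
    apply (E x.pt).map_injective
    refine (cancel_mono ((A N').ι x.pt)).mp ?_
    refine (hm f x.pt).symm.trans (Eq.trans ?_ (hm g x.pt))
    exact congrArg (fun t => (A N).ι x.pt ≫ Invariants.Hom.app t _) h⟩
  have hKF : K.Full := ⟨fun {N N'} k => by
    obtain ⟨f, hf⟩ := (A N).exists_hom_source (A N') hE k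
    exact ⟨f, (A N).hom_unique fun i => (hm f i).trans (hf i).symm⟩⟩
  -- `M'` and the chosen `M N` are assembled from the same `N`, so the identity of `N` induces
  -- inverse isomorphisms between them.
  have hKE : K.EssSurj := ⟨fun M' => by
    obtain ⟨N, ⟨A'⟩⟩ := exists_assembly_source hE T M'
    obtain ⟨p, hp⟩ := (A N).exists_hom A' hE (𝟙 N)
    obtain ⟨q, hq⟩ := A'.exists_hom (A N) hE (𝟙 N)
    simp only [Invariants.id_app, CategoryTheory.Functor.map_id, Category.id_comp] at hp hq
    exact ⟨N, ⟨⟨p, q, (A N).hom_unique fun i => by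
      rw [Invariants.comp_app, reassoc_of% hp, hq]; exact (Category.comp_id _).symm,
      A'.hom_unique fun i => by
      rw [Invariants.comp_app, reassoc_of% hq, hp]; exact (Category.comp_id _).symm⟩⟩⟩⟩
  have : K.IsEquivalence := {}
  have : K.asEquivalence.functor.Additive := hKA
  have : K.asEquivalence.functor.Linear ℂ := hKL
  refine ⟨K.asEquivalence.symm, ?_, ?_⟩
  · exact K.asEquivalence.inverse_additive
  · exact K.asEquivalence.inverseLinear ℂ

end LinAction

/-- `ht` and `hs` say that the partners of an element form exactly one class, so `R` descends to the
graph of a bijection. -/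
theorem exists_quotient_equiv {α : Type u} {β : Type v} (s : Setoid α) (t : Setoid β)
    (R : α → β → Prop) (hl : ∀ x, ∃ y, R x y) (hr : ∀ y, ∃ x, R x y)
    (ht : ∀ {x y y'}, R x y → (R x y' ↔ t y y')) (hs : ∀ {x x' y}, R x y → (R x' y ↔ s x x')) :
    ∃ Φ : Quotient s ≃ Quotient t, ∀ x y, Φ (Quotient.mk s x) = Quotient.mk t y ↔ R x y := by
  choose f hf using hl
  let F : Quotient s → Quotient t := Quotient.lift (fun x => Quotient.mk t (f x)) fun x x' h =>
    Quotient.sound ((ht (hf x)).mp ((hs (hf x')).mpr (s.symm h)))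
  have hF : ∀ x y, F (Quotient.mk s x) = Quotient.mk t y ↔ R x y := fun x y =>
    ⟨fun h => (ht (hf x)).mpr (Quotient.exact h), fun h => Quotient.sound ((ht (hf x)).mp h)⟩
  refine ⟨Equiv.ofBijective F ⟨?_, ?_⟩, hF⟩
  · rintro ⟨x⟩ ⟨x'⟩ h
    have h₁ : R x (f x') := (hF x (f x')).mp h
    exact Quotient.sound ((hs h₁).mp (hf x'))
  · rintro ⟨y⟩
    obtain ⟨x, hx⟩ := hr y
    exact ⟨Quotient.mk s x, (hF x y).mpr hx⟩

/-! ### The band condition and independence of the frame -/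

section Band

open LinAction ActionGroupoid

variable {Q : Type w} [Group Q] {C : Type u} [Category.{v} C] [Preadditive C] [Linear ℂ C]
  {ρ : Q →* Equiv.Perm (SimpleClass C)} {E : SimpleClass C → FdVec ⥤ C}

/-- The band makes `q · E i ℂ` simple of class `ρ q i`, hence isomorphic to `E (ρ q i) ℂ`; linear
functors on `FdVec` that agree on the line are isomorphic. -/
theorem exists_intertwiner_of_band [∀ i, (E i).Full] [∀ i, (E i).Faithful] [∀ i, (E i).Additive]
    [∀ i, (E i).Linear ℂ] (hs : ∀ i, Simple ((E i).obj FdVec.line))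
    (hE : ∀ i, SimpleClass.mk ((E i).obj FdVec.line) (hs i) = i) (a : GroupAction Q C)
    (ha : a.band = ρ) : ∃ b : LinAction (ActionGroupoid ρ) FdVec,
      Nonempty (Intertwiner (a.restrict ρ) b fun x => E x.pt) := by
  have hb : ∀ q i, a.bandFun q i = ρ q i := fun q i => by rw [← ha]; rfl
  have h : ∀ (x y : ActionGroupoid ρ) (g : x ⟶ y),
      Nonempty (E y.pt ≅ E x.pt ⋙ (a.restrict ρ).F g) := by
    intro x y g
    have hxy : SimpleClass.mk ((E y.pt).obj FdVec.line) (hs _) =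
        SimpleClass.mk ((a.act g.val).obj ((E x.pt).obj FdVec.line)) (a.simple_act _ (hs _)) := by
      rw [hE, ← a.bandFun_mk _ _ (hs _), hE]
      have h₁ : ρ g.val x.pt = y.pt := g.2
      exact h₁.symm.trans (hb _ _).symm
    exact (SimpleClass.exact hxy).elim fun i => FdVec.nonempty_iso i
  exact exists_intertwiner_source (a.restrict ρ) (fun x => E x.pt) fun g => (h _ _ g).some

/-- It is not needed that `b_g ℂ` is a line. Since `q · E i ℂ` is nonzero, some vector of `b_g ℂ`
yields a nonzero map to it from `E j ℂ`, and Schur's lemma identifies the classes. -/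
theorem IsTwoVectorSpace.band_eq (hC : IsTwoVectorSpace C) [∀ i, (E i).Additive]
    (hs : ∀ i, Simple ((E i).obj FdVec.line))
    (hE : ∀ i, SimpleClass.mk ((E i).obj FdVec.line) (hs i) = i) {a : GroupAction Q C}
    {b : LinAction (ActionGroupoid ρ) FdVec}
    (T : Intertwiner (a.restrict ρ) b fun x => E x.pt) : a.band = ρ := by
  ext q i
  let j := ρ q i
  have hsi : Simple ((a.act q).obj ((E i).obj FdVec.line)) := a.simple_act q (hs i)
  let θ : (E j).obj ((b.F (homMk q (rfl : ρ q i = j))).obj FdVec.line) ≅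
    (a.act q).obj ((E i).obj FdVec.line) := (T.θ (homMk q rfl)).app _
  have hne : ∃ v : FdVec.line ⟶ (b.F (homMk q (rfl : ρ q i = j))).obj FdVec.line,
      (E j).map v ≫ θ.hom ≠ 0 := by
    by_contra! h
    have h₀ : θ.hom = 0 := FdVec.hom_ext_of_line fun v => by rw [h, Limits.comp_zero]
    apply id_nonzero ((a.act q).obj ((E i).obj FdVec.line))
    rw [← θ.inv_hom_id, h₀, Limits.comp_zero]
  obtain ⟨v, hv⟩ := hne
  have h₁ := hC.mk_eq_of_ne_zero (hs j) hsi hv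
  rw [hE, ← a.bandFun_mk q _ (hs i), hE] at h₁
  exact h₁.symm

/-- A decoration brings its own functors, but their values on the line have the same classes as
those of the fixed family, so the functors are isomorphic and the intertwiner can be moved. -/
theorem nonempty_decoration_iff [∀ i, (E i).Additive] [∀ i, (E i).Linear ℂ]
    (hs : ∀ i, Simple ((E i).obj FdVec.line))
    (hE : ∀ i, SimpleClass.mk ((E i).obj FdVec.line) (hs i) = i) {a : GroupAction Q C}
    {b : LinAction (ActionGroupoid ρ) FdVec} :
    Nonempty (Decoration a b) ↔ Nonempty (Intertwiner (a.restrict ρ) b fun x => E x.pt) := by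
  refine ⟨fun ⟨d⟩ => ?_, fun ⟨T⟩ => ⟨⟨E, inferInstance, inferInstance, hs, hE, T.θ, T.θ_unit,
    T.θ_mul⟩⟩⟩
  have := d.additive
  have := d.linear
  have h : ∀ i, Nonempty (d.E i ≅ E i) := fun i =>
    (SimpleClass.exact ((d.mk_eq i).trans (hE i).symm)).elim fun f => FdVec.nonempty_iso f
  let T : Intertwiner (a.restrict ρ) b fun x => d.E x.pt := ⟨d.θ, d.θ_unit, d.θ_mul⟩
  exact ⟨T.ofIso fun x => (h x.pt).some⟩

end Band

theorem mainTheorem3 {Q : Type w} [Group Q] [Finite Q]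
    {C : Type u} [Category.{v} C] [Preadditive C] [Linear ℂ C] (hC : IsTwoVectorSpace C)
    (ρ : Q →* Equiv.Perm (SimpleClass C)) :
    ∃ Φ : ActionsWithBand ρ ≃ ActionsOnVec ρ,
      ∀ (a : GroupAction Q C) (ha : a.band = ρ) (b : LinAction (ActionGroupoid ρ) FdVec),
        (Φ (ActionsWithBand.mk a ha) = ActionsOnVec.mk b ↔ Nonempty (Decoration a b)) ∧
        (Φ (ActionsWithBand.mk a ha) = ActionsOnVec.mk b →
          LinearlyEquivalent a.Invariants b.Invariants) := by
  have := hC.finite_simpleClass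
  have := Fintype.ofFinite (SimpleClass C)
  obtain ⟨E, hEA, hEL, hs, hmk⟩ := hC.exists_frame
  have hE : IsFrame E := hC.isFrame E hEA hEL hs hmk
  have hfull := hE.full
  have hfaith := hE.faithful
  obtain ⟨Φ, hΦ⟩ := exists_quotient_equiv
    ((LinAction.setoid (SingleObj Q) C).comap
      (Subtype.val : {a : GroupAction Q C // a.band = ρ} → GroupAction Q C))
    (LinAction.setoid (ActionGroupoid ρ) FdVec)
    (fun a b => Nonempty (LinAction.Intertwiner (a.1.restrict ρ) b fun x => E x.pt))
    (fun a => exists_intertwiner_of_band hs hmk a.1 a.2)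
    (fun b => by
      obtain ⟨a, ⟨T⟩⟩ := LinAction.exists_intertwiner_target hE (fun Y => hC.hasBiproduct Y) b
      exact ⟨⟨a, hC.band_eq hs hmk T⟩, ⟨T⟩⟩)
    (fun ⟨T⟩ => ⟨fun ⟨T'⟩ => ⟨T.actionIsoSource T'⟩, fun ⟨e⟩ => ⟨T.ofActionIsoSource e⟩⟩)
    (fun ⟨T⟩ => ⟨fun ⟨T'⟩ => T.nonempty_actionIso hE T', fun ⟨e⟩ => ⟨T.ofActionIso e.restrict⟩⟩)
  refine ⟨Φ, fun a ha b => ⟨(hΦ ⟨a, ha⟩ b).trans (nonempty_decoration_iff hs hmk).symm, fun h => ?_⟩⟩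
  obtain ⟨T⟩ := (hΦ ⟨a, ha⟩ b).mp h
  exact LinAction.linearlyEquivalent_invariants hE (fun Y => hC.hasBiproduct Y) T
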